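/- Let $\ell,m\ge 1$ and let $A(x)\in\mathbb F_2[x]$, $B(y)\in\mathbb F_2[y]$ satisfy $A(x)\mid x^\ell-1$ and $B(y)\mid y^m-1$; put $r_A=\deg A$, $r_B=\deg B$. Let $S_n\in\mathbb F_2^{n\times n}$ be the cyclic permutation matrix $S_n(a_0,\dots,a_{n-1})^T=(a_{n-1},a_0,\dots,a_{n-2})^T$. For a binary matrix $H$ let $\mathcal C_H=\ker H$, and let $d_A,d_B\in\mathbb N\cup\{\infty\}$ be the minimum distances of $\mathcal C_{A(S_\ell)}$ and $\mathcal C_{B(S_m)}$ (the distance of a trivial code being $\infty$). Let $\mathcal Q$ be the bivariate bicycle code of $A(x)$ and $B(y)$, that is, the CSS code with check matrices $H_X=(A\mid B)$, $H_Z=(B^T\mid A^T)$, where $A=A(S_\ell)\otimes \mathbb 1_m$, $B=\mathbb 1_\ell\otimes B(S_m)$. Its checks and qubits come in pairs of an $X$- and a $Z$-check (resp. a horizontal and a vertical qubit, belonging to the left and the right block of columns) at each site $(i,j)$, $0\le i<\ell$, $0\le j<m$, of an $\ell\times m$ lattice. Let $A_{red}$ be $A(S_\ell)$ without its first $r_A$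 rows and $B_{red}$ be $B(S_m)$ without its last $r_B$ columns. Let $\tilde{\mathcal Q}=\mathcal C_{A_{red}}\boxtimes\mathcal C_{B_{red}}^T$ be the hypergraph product, i.e. the CSS code with $$\tilde H_X=(A_{red}\otimes\mathbb 1_m\mid \mathbb 1_{\ell-r_A}\otimes B_{red}),\qquad \tilde H_Z=(\mathbb 1_\ell\otimes B_{red}^T\mid A_{red}^T\otimes\mathbb 1_{m-r_B}).$$ An $[[n,k,d]]$ stabilizer code is one on $n$ qubits whose code space has dimension $2^k$ and whose nontrivial logical operators have minimum weight $d$, with $d=\infty$ if there are none. Then: 1. $\tilde{\mathcal Q}$ is a pruned version of $\mathcal Q$: under the evident inclusions of its qubits and checks, it is a stabilizer code, generated by a subset of the stabilizer generators of $\mathcal Q$, restricted to a subset of the qubits of $\mathcal Q$. 2. If $r_A,r_B\ge 1$, then $\mathcal Q$ has parameters $[[2\ell m,\,2r_Ar_B,\,\min(d_A,d_B)]]$ and $\tilde{\mathcal Q}$ has parameters $[[\ell m+(\ell-r_A)(m-r_B),\,r_Ar_B,\,\min(d_A,d_B)]]$. So half of the logical qubits are lost and the distance is unchanged. If $r_A=0$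 or $r_B=0$, then the parameters are $[[2\ell m,0,\infty]]$ and $[[\ell m+(\ell-r_A)(m-r_B),0,\infty]]$. 3. $\tilde{\mathcal Q}$ uses no periodic boundary and is as local as $\mathcal Q$. Let $E_A=\{(s,0): x^s \text{ occurs in } A\}$ and $E_B=\{(0,t): y^t\text{ occurs in }B\}$. For each edge of the Tanner graph of $\mathcal Q$, the displacement (position of the check) minus (position of the qubit) is, modulo $\ell\mathbb Z\times m\mathbb Z$, in $E_A$ for an $X$-check and a horizontal qubit, in $E_B$ for an $X$-check and a vertical qubit, in $-E_B$ for a $Z$-check and a horizontal qubit, and in $-E_A$ for a $Z$-check and a vertical qubit. For each edge of the Tanner graph of $\tilde{\mathcal Q}$, with all checks and qubits kept at their positions, the same holds exactly in $\mathbb Z^2$, without reduction modulo $\ell\mathbb Z\times m\mathbb Z$. In particular, each edge of $\mathcal Q$ has range at most $\max(r_A,r_B)$ (in both coordinates) on the periodic lattice, and each edge of $\tilde{\mathcal Q}$ has range at most $\max(r_A,r_B)$ on the lattice with open boundary. -/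

import Mathlib

open Polynomial
open scoped Kronecker

noncomputable section

namespace PrunedBB

/-! ### Classical linear codes -/

/-- The minimum distance of the binary linear code `ker H` with parity check matrix `H`:
the least Hamming weight of a nonzero codeword, `⊤` if the code is trivial. -/
def classicalDistance {R C : Type*} [Fintype C] (H : Matrix R C (ZMod 2)) : ℕ∞ :=
  ⨅ v ∈ {v : C → ZMod 2 | H.mulVec v = 0 ∧ v ≠ 0}, (hammingNorm v : ℕ∞)

/-- The cyclic permutation matrix `S_n`, i.e. `S_n (a₀, …, a_{n-1}) = (a_{n-1}, a₀, …, a_{n-2})`. -/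
def cyclicShift (n : ℕ) : Matrix (Fin n) (Fin n) (ZMod 2) :=
  Matrix.of fun i j => if (i : ℕ) = ((j : ℕ) + 1) % n then 1 else 0

/-- The circulant matrix `h(S_n)`. -/
def circulantOf (n : ℕ) (h : (ZMod 2)[X]) : Matrix (Fin n) (Fin n) (ZMod 2) :=
  aeval (cyclicShift n) h

/-! ### Stabilizer codes on qubits labelled by a finite type `Q` -/

/-- The Hilbert space `(ℂ²)^{⊗ Q}`, a vector being given by its amplitudes in the computational
basis `|v⟩`, `v ∈ 𝔽₂^Q`. -/
abbrev QState (Q : Type*) : Type _ := (Q → ZMod 2) → ℂ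

/-- A Pauli string `⨂_q X^{x q} Z^{z q}` (no phase), a row `(x | z)` of a check matrix. -/
@[ext]
structure PauliString (Q : Type*) where
  x : Q → ZMod 2
  z : Q → ZMod 2

namespace PauliString

variable {Q : Type*}

/-- The operator `⨂_q X^{x q} Z^{z q}`, that is `|w⟩ ↦ (-1)^{z·w} |w + x⟩`, in terms of
amplitudes. -/
def op [Fintype Q] (p : PauliString Q) : Module.End ℂ (QState Q) where
  toFun ψ v := (-1 : ℂ) ^ (∑ q, p.z q * (v q - p.x q)).val * ψ (v - p.x)
  map_add' ψ φ := by
    funext v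
    simp [mul_add]
  map_smul' c ψ := by
    funext v
    simp [mul_left_comm]

/-- The string acts nontrivially on the qubit `q`. -/
def ActsOn (p : PauliString Q) (q : Q) : Prop := p.x q ≠ 0 ∨ p.z q ≠ 0

/-- The Hamming weight: the number of qubits on which the string acts nontrivially. -/
def weight (p : PauliString Q) : ℕ := {q | p.ActsOn q}.ncard

end PauliString

section Stabilizer

variable {Q ι : Type*} [Fintype Q]

/-- The stabilizer group generated by the `S i`. (Every Pauli operator has finite order, so the
generated submonoid is the generated group.) -/
def stabilizerGroup (S : ι → PauliString Q) : Submonoid (Module.End ℂ (QState Q)) :=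
  Submonoid.closure (Set.range fun i => (S i).op)

/-- The generators commute and no product of them is `-1`. -/
def IsStabilizerCode (S : ι → PauliString Q) : Prop :=
  (∀ i j, Commute (S i).op (S j).op) ∧ (-1 : Module.End ℂ (QState Q)) ∉ stabilizerGroup S

/-- The code space: the joint `+1`-eigenspace of the generators. -/
def codeSpace (S : ι → PauliString Q) : Submodule ℂ (QState Q) :=
  ⨅ i, Module.End.eigenspace (S i).op 1

/-- Nontrivial logical operators, modulo phases: Pauli operators that commute with all generators
and that do not lie, up to a phase `i^c`, in the stabilizer group. -/
def IsNontrivialLogical (S : ι → PauliString Q) (p : PauliString Q) : Prop :=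
  (∀ i, Commute p.op (S i).op) ∧ ∀ c : ℕ, (Complex.I ^ c) • p.op ∉ stabilizerGroup S

/-- The distance: least weight of a nontrivial logical operator, `⊤` if there is none. -/
def distance (S : ι → PauliString Q) : ℕ∞ :=
  ⨅ p ∈ {p : PauliString Q | IsNontrivialLogical S p}, (p.weight : ℕ∞)

/-- `S` generates an `[[n, k, d]]` stabilizer code. -/
structure HasParameters (S : ι → PauliString Q) (n k : ℕ) (d : ℕ∞) : Prop where
  isStabilizerCode : IsStabilizerCode S
  physical : Fintype.card Q = n
  logical : Module.finrank ℂ (codeSpace S) = 2 ^ k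
  distance_eq : distance S = d

/-- `T` is the pruned code derived from `S` that keeps the qubits in the range of `f` and the
stabilizer generators in the range of `g`, the latter being restricted to the former. -/
structure IsPrunedVersion {Q' ι' : Type*} [Fintype Q'] (T : ι' → PauliString Q')
    (S : ι → PauliString Q) (f : Q' → Q) (g : ι' → ι) : Prop where
  isStabilizerCode : IsStabilizerCode T
  qubit_injective : Function.Injective f
  check_injective : Function.Injective g
  restrict_x : ∀ i q, (T i).x q = (S (g i)).x (f q)
  restrict_z : ∀ i q, (T i).z q = (S (g i)).z (f q)

end Stabilizer

/-- The generators of the CSS code with `X`-check matrix `HX` and `Z`-check matrix `HZ`. -/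
def cssCode {Q RX RZ : Type*} (HX : Matrix RX Q (ZMod 2)) (HZ : Matrix RZ Q (ZMod 2)) :
    RX ⊕ RZ → PauliString Q :=
  Sum.elim (fun i => ⟨HX i, 0⟩) (fun i => ⟨0, HZ i⟩)

/-- The hypergraph product `C₁ ⊠ C₂` of the classical codes with parity check matrices `H₁`, `H₂`:
`H_X = (H₁ ⊗ 1 | 1 ⊗ H₂ᵀ)` and `H_Z = (1 ⊗ H₂ | H₁ᵀ ⊗ 1)`. -/
def hypergraphProduct {R₁ C₁ R₂ C₂ : Type*} [DecidableEq R₁] [DecidableEq C₁] [DecidableEq R₂]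
    [DecidableEq C₂] (H₁ : Matrix R₁ C₁ (ZMod 2)) (H₂ : Matrix R₂ C₂ (ZMod 2)) :
    (R₁ × C₂) ⊕ (C₁ × R₂) → PauliString ((C₁ × C₂) ⊕ (R₁ × R₂)) :=
  cssCode
    (Matrix.fromCols (H₁ ⊗ₖ (1 : Matrix C₂ C₂ (ZMod 2))) ((1 : Matrix R₁ R₁ (ZMod 2)) ⊗ₖ H₂.transpose))
    (Matrix.fromCols ((1 : Matrix C₁ C₁ (ZMod 2)) ⊗ₖ H₂) (H₁.transpose ⊗ₖ (1 : Matrix R₂ R₂ (ZMod 2))))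

/-! ### Bivariate bicycle codes -/

/-- The cells of the `ℓ × m` lattice. -/
abbrev Cell (ℓ m : ℕ) : Type := Fin ℓ × Fin m

/-- `P(x, y)` for `x = S_ℓ ⊗ 1_m` and `y = 1_ℓ ⊗ S_m`. -/
def bivariateEval (ℓ m : ℕ) (P : MvPolynomial (Fin 2) (ZMod 2)) :
    Matrix (Cell ℓ m) (Cell ℓ m) (ZMod 2) :=
  ∑ e ∈ P.support, P.coeff e •
    ((cyclicShift ℓ ⊗ₖ (1 : Matrix (Fin m) (Fin m) (ZMod 2))) ^ e 0 *
      ((1 : Matrix (Fin ℓ) (Fin ℓ) (ZMod 2)) ⊗ₖ cyclicShift m) ^ e 1)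

/-- The bivariate bicycle code of `A(x, y)` and `B(x, y)`: `H_X = (A | B)`, `H_Z = (Bᵀ | Aᵀ)`.
The qubits `inl` are the horizontal, `inr` the vertical ones; the generators `inl` are the
`X`-checks, `inr` the `Z`-checks. -/
def bivariateBicycle (ℓ m : ℕ) (A B : MvPolynomial (Fin 2) (ZMod 2)) :
    Cell ℓ m ⊕ Cell ℓ m → PauliString (Cell ℓ m ⊕ Cell ℓ m) :=
  cssCode (Matrix.fromCols (bivariateEval ℓ m A) (bivariateEval ℓ m B))
    (Matrix.fromCols (bivariateEval ℓ m B).transpose (bivariateEval ℓ m A).transpose)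

/-- `A(x)` as a bivariate polynomial. -/
def inX (A : (ZMod 2)[X]) : MvPolynomial (Fin 2) (ZMod 2) := aeval (MvPolynomial.X 0) A

/-- `B(y)` as a bivariate polynomial. -/
def inY (B : (ZMod 2)[X]) : MvPolynomial (Fin 2) (ZMod 2) := aeval (MvPolynomial.X 1) B

/-! ### The pruned code -/

/-- The row indices that remain after deleting the first `r` of `ℓ` rows. -/
abbrev KeptRow (ℓ r : ℕ) : Type := {i : Fin ℓ // r ≤ (i : ℕ)}

/-- The column indices that remain after deleting the last `r` of `m` columns. -/
abbrev KeptCol (m r : ℕ) : Type := {j : Fin m // (j : ℕ) + r < m}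

/-- `A_red`: the matrix `A(S_ℓ)` without its first `deg A` rows. -/
def redA (ℓ : ℕ) (A : (ZMod 2)[X]) : Matrix (KeptRow ℓ A.natDegree) (Fin ℓ) (ZMod 2) :=
  (circulantOf ℓ A).submatrix Subtype.val id

/-- `B_red`: the matrix `B(S_m)` without its last `deg B` columns. -/
def redB (m : ℕ) (B : (ZMod 2)[X]) : Matrix (Fin m) (KeptCol m B.natDegree) (ZMod 2) :=
  (circulantOf m B).submatrix id Subtype.val

/-- The inclusion of the qubits of `C_{A_red} ⊠ C_{B_red}ᵀ` into those of the bicycle code. -/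
def keepQubit {ℓ m r s : ℕ} :
    (Fin ℓ × Fin m) ⊕ (KeptRow ℓ r × KeptCol m s) → Cell ℓ m ⊕ Cell ℓ m :=
  Sum.map id (Prod.map Subtype.val Subtype.val)

/-- The inclusion of the checks of `C_{A_red} ⊠ C_{B_red}ᵀ` into those of the bicycle code. -/
def keepCheck {ℓ m r s : ℕ} :
    (KeptRow ℓ r × Fin m) ⊕ (Fin ℓ × KeptCol m s) → Cell ℓ m ⊕ Cell ℓ m :=
  Sum.map (Prod.map Subtype.val id) (Prod.map id Subtype.val)

/-! ### Locality on the lattice -/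

/-- The lattice position of a check or qubit of a bicycle code. -/
def pos {ℓ m : ℕ} : Cell ℓ m ⊕ Cell ℓ m → ℤ × ℤ :=
  Sum.elim (fun c => ((c.1 : ℕ), (c.2 : ℕ))) (fun c => ((c.1 : ℕ), (c.2 : ℕ)))

/-- The exponents of the monomials occurring in `P(x, y)`. -/
def exponents (P : MvPolynomial (Fin 2) (ZMod 2)) : Set (ℤ × ℤ) :=
  {e | ∃ μ ∈ P.support, e = ((μ 0 : ℤ), (μ 1 : ℤ))}

/-- The displacements `(check) - (qubit)` prescribed by the polynomials: an `X`-check sees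
horizontal qubits through `A`, vertical ones through `B`; a `Z`-check sees horizontal qubits
through `B`, vertical ones through `A`, with the opposite sign. -/
def stencil {κ κ' Λ Λ' : Type*} (A B : MvPolynomial (Fin 2) (ZMod 2)) :
    κ ⊕ κ' → Λ ⊕ Λ' → Set (ℤ × ℤ)
  | .inl _, .inl _ => exponents A
  | .inl _, .inr _ => exponents B
  | .inr _, .inl _ => {e | -e ∈ exponents B}
  | .inr _, .inr _ => {e | -e ∈ exponents A}

/-- The displacements of size at most `R` in both coordinates. -/
def box (R : ℕ) : Set (ℤ × ℤ) := {e | |e.1| ≤ (R : ℤ) ∧ |e.2| ≤ (R : ℤ)}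

/-- On the lattice with periodic boundary conditions of periods `ℓ` and `m`, each edge of the
Tanner graph joins a check to a qubit along a displacement in `D`. -/
def IsLocalPeriodic {Q ι : Type*} (ℓ m : ℕ) (S : ι → PauliString Q) (posC : ι → ℤ × ℤ)
    (posQ : Q → ℤ × ℤ) (D : ι → Q → Set (ℤ × ℤ)) : Prop :=
  ∀ i q, (S i).ActsOn q → ∃ e ∈ D i q, ∃ a b : ℤ, posC i - posQ q = e + (a * ℓ, b * m)

/-- On the lattice with open boundary conditions, each edge of the Tanner graph joins a check to a
qubit along a displacement in `D`; no edge goes over a periodic boundary. -/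
def IsLocalOpen {Q ι : Type*} (S : ι → PauliString Q) (posC : ι → ℤ × ℤ)
    (posQ : Q → ℤ × ℤ) (D : ι → Q → Set (ℤ × ℤ)) : Prop :=
  ∀ i q, (S i).ActsOn q → posC i - posQ q ∈ D i q

/-- The bivariate bicycle code of the univariate polynomials `A(x)` and `B(y)`. -/
def parentCode (ℓ m : ℕ) (A B : (ZMod 2)[X]) :
    Cell ℓ m ⊕ Cell ℓ m → PauliString (Cell ℓ m ⊕ Cell ℓ m) :=
  bivariateBicycle ℓ m (inX A) (inY B)

/-- The hypergraph product `C_{A_red} ⊠ C_{B_red}ᵀ`. -/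
def prunedCode (ℓ m : ℕ) (A B : (ZMod 2)[X]) :
    (KeptRow ℓ A.natDegree × Fin m) ⊕ (Fin ℓ × KeptCol m B.natDegree) →
      PauliString ((Fin ℓ × Fin m) ⊕ (KeptRow ℓ A.natDegree × KeptCol m B.natDegree)) :=
  hypergraphProduct (redA ℓ A) (redB m B).transpose

end PrunedBB

end

/-!
Both codes are hypergraph products over `𝔽₂`: the bicycle code is the product of `A(S_ℓ)` and
`B(S_m)ᵀ` (`parentCode_eq`), the pruned code that of `A_red` and `B_redᵀ`. So the parameters follow
from general facts on hypergraph products, applied to two different pairs of matrices.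

The stabilizer group of a CSS code consists of the unsigned Pauli strings with parts in the row
spaces of the check matrices (`mem_stabilizerGroup_cssCode`). Hence the code space has dimension
`2 ^ (n - rank H_X - rank H_Z)` (`finrank_codeSpace_cssCode`), and nontrivial logical operators are
the nontrivial (co)homology classes of the complex `H_X H_Zᵀ = 0`
(`isNontrivialLogical_cssCode_iff`).

For a hypergraph product of `H₁` and `H₂`, a `Z`-type logical operator is a pair of matrices `(U, V)`
with `H₁ U = V H₂`, trivial if `(U, V) = (W H₂, H₁ W)`. A Künneth count of dimensions gives
`dim ker H₁ * dim ker H₂ + dim ker H₁ᵀ * dim ker H₂ᵀ` logical qubits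
(`finrank_codeSpace_hypergraphProduct`). If `U` kills `ker H₂` and `V` is killed by `ker H₁ᵀ`, then
`(U, V)` is trivial (`exists_eq_mul_and_eq_mul`, by generalized inverses); otherwise some `U b` is a
nonzero codeword of `H₁`, or some `cᵀ V` one of `H₂ᵀ`, and `(U, V)` has at least its weight
(`le_distance_hypergraphProduct`). Conversely, a codeword of one factor placed in a single row or
column is a nontrivial logical operator as soon as the other factor has a nonzero codeword.

It remains to know the classical codes. The matrix `A_red` has independent rows, as these begin with
the leading coefficient of `A` in different columns, so `dim ker A_red = deg A` and
`ker A_redᵀ = 0`. The circulant of the cofactor `(x^ℓ - 1) / A` maps into `ker A(S_ℓ)`, whence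
`dim ker A(S_ℓ) = deg A` too (`finrank_ker_circulantOf`) and both kernels agree. Thus the second
Künneth term equals the first for the bicycle code and vanishes for the pruned code, and the
distances coincide. Reversing the order of coordinates transposes a circulant and turns `A_red`
into `B_redᵀ` (`redB_transpose`), so `B` needs no separate treatment.

Locality is read off the matrix entries: the deleted rows of `A(S_ℓ)` and columns of `B(S_m)` are the
ones that wrap around the boundary.
-/

namespace PrunedBB

/-! ### Pauli strings and CSS codes -/

/-- The nontrivial character `a ↦ (-1)^a` of `𝔽₂`. -/
def sign (a : ZMod 2) : ℂ := (-1 : ℂ) ^ a.val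

@[simp] lemma sign_zero : sign 0 = 1 := by simp [sign]

lemma sign_one : sign 1 = -1 := by simp [sign, ZMod.val_one]

lemma zmod_two_cases (a : ZMod 2) : a = 0 ∨ a = 1 := by
  revert a; decide

lemma sign_add (a b : ZMod 2) : sign (a + b) = sign a * sign b := by
  have h : (1 + 1 : ZMod 2) = 0 := by decide
  rcases zmod_two_cases a with rfl | rfl <;> rcases zmod_two_cases b with rfl | rfl <;>
    simp [sign_one, h]

lemma sign_ne_zero (a : ZMod 2) : sign a ≠ 0 := by simp [sign]

lemma sign_injective : Function.Injective sign := by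
  intro a b h
  rcases zmod_two_cases a with rfl | rfl <;> rcases zmod_two_cases b with rfl | rfl <;>
    first
    | rfl
    | (exfalso; norm_num [sign_one] at h)

namespace PauliString

variable {Q : Type*} [Fintype Q]

lemma op_apply (p : PauliString Q) (ψ : QState Q) (v : Q → ZMod 2) :
    p.op ψ v = sign (p.z ⬝ᵥ (v - p.x)) * ψ (v - p.x) := rfl

lemma op_mul (p q : PauliString Q) :
    p.op * q.op = sign (p.z ⬝ᵥ q.x) • op ⟨p.x + q.x, p.z + q.z⟩ := by
  refine LinearMap.ext fun ψ => funext fun v => ?_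
  have hv : v - (p.x + q.x) = v - p.x - q.x := by abel
  have hp : p.z ⬝ᵥ (v - p.x) = p.z ⬝ᵥ q.x + p.z ⬝ᵥ (v - p.x - q.x) := by
    rw [← dotProduct_add]; congr 1; abel
  simp only [Module.End.mul_apply, op_apply, LinearMap.smul_apply, Pi.smul_apply, smul_eq_mul, hv,
    add_dotProduct, hp, sign_add]
  ring

/-- Pauli strings are determined by their operator, even up to a scalar; the scalar is then `1`
since no phases are attached to strings. -/
lemma eq_of_smul_op_eq {c : ℂ} {p q : PauliString Q} (h : c • p.op = q.op) : c = 1 ∧ p = q := by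
  classical
  -- compare the amplitudes at `v` of the images of the basis state `|w⟩`
  have key : ∀ w v : Q → ZMod 2, c * (sign (p.z ⬝ᵥ (v - p.x)) * if v - p.x = w then 1 else 0) =
      sign (q.z ⬝ᵥ (v - q.x)) * if v - q.x = w then 1 else 0 := by
    intro w v
    have := congrFun (LinearMap.congr_fun h (fun u => if u = w then 1 else 0)) v
    simpa [op_apply] using this
  have hx : p.x = q.x := by
    by_contra hne
    have := key 0 q.x
    have h2 : q.x - p.x ≠ 0 := fun h => hne (sub_eq_zero.mp h).symm
    simp [h2] at this
  have hc : c = 1 := by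
    have := key 0 p.x
    simpa [hx] using this
  refine ⟨hc, PauliString.ext hx ?_⟩
  have : ∀ w, p.z ⬝ᵥ w = q.z ⬝ᵥ w := by
    intro w
    have := key w (w + q.x)
    simp [hx, hc] at this
    exact sign_injective this
  exact dotProduct_eq _ _ this

lemma commute_op_iff (p q : PauliString Q) :
    Commute p.op q.op ↔ p.z ⬝ᵥ q.x = q.z ⬝ᵥ p.x := by
  rw [commute_iff_eq, op_mul, op_mul, add_comm q.x, add_comm q.z]
  constructor
  · intro h
    have h2 := congrArg (fun T => (sign (q.z ⬝ᵥ p.x))⁻¹ • T) h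
    simp only [smul_smul, inv_mul_cancel₀ (sign_ne_zero _), one_smul] at h2
    have h3 := (eq_of_smul_op_eq h2).1
    rw [inv_mul_eq_one₀ (sign_ne_zero _)] at h3
    exact (sign_injective h3).symm
  · intro h; rw [h]

lemma op_one : op (⟨0, 0⟩ : PauliString Q) = 1 := by
  refine LinearMap.ext fun ψ => funext fun v => ?_
  simp [op_apply]

end PauliString

section CSS

variable {Q RX RZ : Type*} [Fintype Q]
  {HX : Matrix RX Q (ZMod 2)} {HZ : Matrix RZ Q (ZMod 2)}

lemma op_x_mem_stabilizerGroup [Fintype RX] (a : RX → ZMod 2) :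
    PauliString.op ⟨Matrix.vecMul a HX, 0⟩ ∈ stabilizerGroup (cssCode HX HZ) := by
  classical
  rw [Matrix.vecMul_eq_sum]
  induction (Finset.univ : Finset RX) using Finset.induction_on with
  | empty => rw [Finset.sum_empty, PauliString.op_one]; exact one_mem _
  | insert i s hi ih =>
    rw [Finset.sum_insert hi]
    have hi' : PauliString.op ⟨a i • HX i, 0⟩ ∈ stabilizerGroup (cssCode HX HZ) := by
      rcases zmod_two_cases (a i) with h | h
      · rw [h, zero_smul, PauliString.op_one]; exact one_mem _
      · rw [h, one_smul]; exact Submonoid.subset_closure ⟨Sum.inl i, rfl⟩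
    have := mul_mem hi' ih
    rw [PauliString.op_mul] at this
    simpa using this

lemma op_z_mem_stabilizerGroup [Fintype RZ] (b : RZ → ZMod 2) :
    PauliString.op ⟨0, Matrix.vecMul b HZ⟩ ∈ stabilizerGroup (cssCode HX HZ) := by
  classical
  rw [Matrix.vecMul_eq_sum]
  induction (Finset.univ : Finset RZ) using Finset.induction_on with
  | empty => rw [Finset.sum_empty, PauliString.op_one]; exact one_mem _
  | insert i s hi ih =>
    rw [Finset.sum_insert hi]
    have hi' : PauliString.op ⟨0, b i • HZ i⟩ ∈ stabilizerGroup (cssCode HX HZ) := by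
      rcases zmod_two_cases (b i) with h | h
      · rw [h, zero_smul, PauliString.op_one]; exact one_mem _
      · rw [h, one_smul]; exact Submonoid.subset_closure ⟨Sum.inr i, rfl⟩
    have := mul_mem hi' ih
    rw [PauliString.op_mul] at this
    simpa using this

variable [Fintype RX] [Fintype RZ]

lemma vecMul_dotProduct_vecMul_eq_zero (h : HX * HZ.transpose = 0) (a : RX → ZMod 2)
    (b : RZ → ZMod 2) : Matrix.vecMul b HZ ⬝ᵥ Matrix.vecMul a HX = 0 := by
  rw [dotProduct_comm, ← Matrix.dotProduct_mulVec, ← Matrix.mulVec_transpose,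
    Matrix.mulVec_mulVec, h, Matrix.zero_mulVec, dotProduct_zero]

/-- No signs occur in the stabilizer group of a CSS code: it consists of the Pauli strings whose
`X`-part is in the row space of `H_X` and whose `Z`-part is in that of `H_Z`. -/
lemma mem_stabilizerGroup_cssCode (h : HX * HZ.transpose = 0)
    (T : Module.End ℂ (QState Q)) :
    T ∈ stabilizerGroup (cssCode HX HZ) ↔
      ∃ a b, T = PauliString.op ⟨Matrix.vecMul a HX, Matrix.vecMul b HZ⟩ := by
  classical
  constructor
  · intro hT
    induction hT using Submonoid.closure_induction with
    | mem T hT =>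
      obtain ⟨i | i, rfl⟩ := hT
      · exact ⟨Pi.single i 1, 0, by simp [cssCode, Matrix.row]⟩
      · exact ⟨0, Pi.single i 1, by simp [cssCode, Matrix.row]⟩
    | one => exact ⟨0, 0, by simp [PauliString.op_one]⟩
    | mul T T' _ _ hT hT' =>
      obtain ⟨a, b, rfl⟩ := hT
      obtain ⟨a', b', rfl⟩ := hT'
      refine ⟨a + a', b + b', ?_⟩
      rw [PauliString.op_mul]
      simp only [vecMul_dotProduct_vecMul_eq_zero h, sign_zero, one_smul, Matrix.add_vecMul]
  · rintro ⟨a, b, rfl⟩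
    have := mul_mem (op_x_mem_stabilizerGroup (HX := HX) (HZ := HZ) a)
      (op_z_mem_stabilizerGroup (HX := HX) b)
    rw [PauliString.op_mul] at this
    simpa using this

lemma isStabilizerCode_cssCode (h : HX * HZ.transpose = 0) :
    IsStabilizerCode (cssCode HX HZ) := by
  have hxz : ∀ i j, HZ j ⬝ᵥ HX i = 0 := by
    intro i j
    rw [dotProduct_comm]
    exact congrFun (congrFun h i) j
  refine ⟨?_, ?_⟩
  · rintro (i | i) (j | j) <;> rw [PauliString.commute_op_iff] <;> simp [cssCode, hxz]
  · rw [mem_stabilizerGroup_cssCode h]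
    rintro ⟨a, b, hab⟩
    have h1 : (-1 : ℂ) • PauliString.op (⟨0, 0⟩ : PauliString Q) =
        PauliString.op ⟨Matrix.vecMul a HX, Matrix.vecMul b HZ⟩ := by
      rw [← hab, PauliString.op_one]
      exact neg_one_smul ℂ (1 : Module.End ℂ (QState Q))
    have := (PauliString.eq_of_smul_op_eq h1).1
    norm_num at this

lemma isNontrivialLogical_cssCode_iff (h : HX * HZ.transpose = 0) (p : PauliString Q) :
    IsNontrivialLogical (cssCode HX HZ) p ↔
      HX.mulVec p.z = 0 ∧ HZ.mulVec p.x = 0 ∧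
        ((¬ ∃ a, p.x = Matrix.vecMul a HX) ∨ ¬ ∃ b, p.z = Matrix.vecMul b HZ) := by
  have h1 : (∀ i, Commute p.op (cssCode HX HZ i).op) ↔
      HX.mulVec p.z = 0 ∧ HZ.mulVec p.x = 0 := by
    simp only [PauliString.commute_op_iff, Sum.forall, funext_iff]
    refine and_congr (forall_congr' fun i => ?_) (forall_congr' fun i => ?_)
    · simp [cssCode, Matrix.mulVec, dotProduct_comm]
    · simp [cssCode, Matrix.mulVec, eq_comm]
  have h2 : (∀ c : ℕ, (Complex.I ^ c) • p.op ∉ stabilizerGroup (cssCode HX HZ)) ↔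
      ((¬ ∃ a, p.x = Matrix.vecMul a HX) ∨ ¬ ∃ b, p.z = Matrix.vecMul b HZ) := by
    rw [← not_and_or, ← not_exists, not_iff_not]
    constructor
    · rintro ⟨c, hc⟩
      obtain ⟨a, b, hab⟩ := (mem_stabilizerGroup_cssCode h _).1 hc
      obtain ⟨-, rfl⟩ := PauliString.eq_of_smul_op_eq hab
      exact ⟨⟨a, rfl⟩, b, rfl⟩
    · rintro ⟨⟨a, ha⟩, b, hb⟩
      refine ⟨0, (mem_stabilizerGroup_cssCode h _).2 ⟨a, b, ?_⟩⟩
      rw [pow_zero, one_smul, ← ha, ← hb]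
  rw [IsNontrivialLogical, h1, h2, and_assoc]

lemma mem_codeSpace_cssCode (ψ : QState Q) :
    ψ ∈ codeSpace (cssCode HX HZ) ↔
      (∀ a v, ψ (v + Matrix.vecMul a HX) = ψ v) ∧ ∀ v, HZ.mulVec v ≠ 0 → ψ v = 0 := by
  classical
  simp only [codeSpace, Submodule.mem_iInf, Module.End.mem_eigenspace_iff, one_smul, Sum.forall]
  refine and_congr ⟨fun h a => ?_, fun h i => ?_⟩ ⟨fun h v hv => ?_, fun h i => ?_⟩
  · rw [Matrix.vecMul_eq_sum]
    have h0 : ∀ i v, ψ (v + HX i) = ψ v := by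
      intro i v
      have := congrFun (h i) (v + HX i)
      simpa [PauliString.op_apply, cssCode] using this.symm
    induction (Finset.univ : Finset RX) using Finset.induction_on with
    | empty => simp
    | insert i s hi ih =>
      intro v
      rw [Finset.sum_insert hi, ← add_assoc, ih]
      rcases zmod_two_cases (a i) with hi | hi <;> rw [hi]
      · simp
      · rw [one_smul, h0]
  · funext v
    have := h (Pi.single i 1) (v - HX i)
    simp [Matrix.row] at this
    simp [PauliString.op_apply, cssCode, this]
  · obtain ⟨i, hi⟩ := Function.ne_iff.1 hv
    have := congrFun (h i) v
    simp only [cssCode, Sum.elim_inr, PauliString.op_apply, sub_zero] at this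
    rcases zmod_two_cases (HZ i ⬝ᵥ v) with h1 | h1
    · exact absurd h1 hi
    · rw [h1, sign_one] at this
      linear_combination (-1/2 : ℂ) * this
  · funext v
    simp only [cssCode, Sum.elim_inr, PauliString.op_apply, sub_zero]
    by_cases hv : HZ.mulVec v = 0
    · have : HZ i ⬝ᵥ v = 0 := congrFun hv i
      rw [this, sign_zero, one_mul]
    · rw [h v hv, mul_zero]

/-- A code state is a function on `ker H_Z` that is invariant under translations by the row space of
`H_X`, so the code space has a basis indexed by the quotient. -/
lemma finrank_codeSpace_cssCode (h : HX * HZ.transpose = 0) {k : ℕ}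
    (hk : HX.rank + HZ.rank + k = Fintype.card Q) :
    Module.finrank ℂ (codeSpace (cssCode HX HZ)) = 2 ^ k := by
  classical
  let K : Submodule (ZMod 2) (Q → ZMod 2) := LinearMap.ker HZ.mulVecLin
  let R : Submodule (ZMod 2) (Q → ZMod 2) := LinearMap.range HX.transpose.mulVecLin
  have hmemK : ∀ v, v ∈ K ↔ HZ.mulVec v = 0 := fun v => by simp [K]
  have hmemR : ∀ v, v ∈ R ↔ ∃ a, Matrix.vecMul a HX = v := fun v => by
    simp [R]
  have hRK : R ≤ K := by
    intro v hv
    obtain ⟨a, rfl⟩ := (hmemR v).1 hv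
    have h' : HZ * HX.transpose = 0 := by
      rw [← Matrix.transpose_transpose (HZ * HX.transpose), Matrix.transpose_mul,
        Matrix.transpose_transpose, h, Matrix.transpose_zero]
    rw [hmemK, ← Matrix.mulVec_transpose, Matrix.mulVec_mulVec, h', Matrix.zero_mulVec]
  let R' : Submodule (ZMod 2) K := R.submoduleOf K
  have : Fintype (K ⧸ R') := Fintype.ofFinite _
  -- a function on the quotient, extended by zero to all computational basis states
  let L : ((K ⧸ R') → ℂ) →ₗ[ℂ] QState Q :=
    { toFun := fun f v => if hv : v ∈ K then f (Submodule.Quotient.mk ⟨v, hv⟩) else 0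
      map_add' := fun f g => by
        funext v; by_cases hv : v ∈ K <;> simp [hv]
      map_smul' := fun c f => by
        funext v; by_cases hv : v ∈ K <;> simp [hv] }
  have hL : ∀ f v, L f v = if hv : v ∈ K then f (Submodule.Quotient.mk ⟨v, hv⟩) else 0 :=
    fun _ _ => rfl
  have hinj : Function.Injective L := by
    intro f g hfg
    funext q
    obtain ⟨⟨v, hv⟩, rfl⟩ := Submodule.Quotient.mk_surjective _ q
    have := congrFun hfg v
    simpa [hL, hv] using this
  have hrange : LinearMap.range L = codeSpace (cssCode HX HZ) := by
    ext ψ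
    rw [mem_codeSpace_cssCode]
    constructor
    · rintro ⟨f, rfl⟩
      refine ⟨fun a v => ?_, fun v hv => ?_⟩
      · have haR : Matrix.vecMul a HX ∈ R := (hmemR _).2 ⟨a, rfl⟩
        have haK := hRK haR
        have hiff : v + Matrix.vecMul a HX ∈ K ↔ v ∈ K := Submodule.add_mem_iff_left _ haK
        by_cases hv : v ∈ K
        · simp only [hL, hv, hiff.2 hv, dif_pos]
          congr 1
          rw [Submodule.Quotient.eq]
          show v + Matrix.vecMul a HX - v ∈ R
          rwa [add_sub_cancel_left]
        · simp only [hL, hv, mt hiff.1 hv, dif_neg, not_false_eq_true]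
      · rw [hL, dif_neg (mt (hmemK v).1 hv)]
    · rintro ⟨hinv, hsupp⟩
      refine ⟨fun q => ψ (Quotient.out q : K), ?_⟩
      funext v
      by_cases hv : v ∈ K
      · rw [hL, dif_pos hv]
        set q : K ⧸ R' := Submodule.Quotient.mk ⟨v, hv⟩ with hq
        have hout : (Submodule.Quotient.mk (Quotient.out q) : K ⧸ R') =
            Submodule.Quotient.mk ⟨v, hv⟩ := Quotient.out_eq q
        rw [Submodule.Quotient.eq] at hout
        obtain ⟨a, ha⟩ := (hmemR _).1 (show ((Quotient.out q - ⟨v, hv⟩ : K) : Q → ZMod 2) ∈ R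
          from hout)
        rw [← hinv a v, ha]
        simp
      · rw [hL, dif_neg hv, hsupp v (mt (hmemK v).2 hv)]
  rw [← hrange, LinearMap.finrank_range_of_inj hinj, Module.finrank_fintype_fun_eq_card,
    Module.card_eq_pow_finrank (K := ZMod 2), ZMod.card]
  congr 1
  have h1 : Module.finrank (ZMod 2) (K ⧸ R') + Module.finrank (ZMod 2) R' =
      Module.finrank (ZMod 2) K := Submodule.finrank_quotient_add_finrank R'
  have h2 : Module.finrank (ZMod 2) R' = HX.rank := by
    rw [(Submodule.submoduleOfEquivOfLe hRK).finrank_eq, ← Matrix.rank_transpose HX, Matrix.rank]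
  have h3 : HZ.rank + Module.finrank (ZMod 2) K = Fintype.card Q := by
    rw [Matrix.rank, LinearMap.finrank_range_add_finrank_ker, Module.finrank_fintype_fun_eq_card]
  omega

end CSS

/-! ### Matrix equations over a field -/

section MatrixEquations

variable {F : Type*} [Field F]

/-- Every matrix over a field has a generalized inverse. -/
lemma exists_mul_mul_eq_self {R C : Type*} [Fintype R] [Fintype C] [DecidableEq R] [DecidableEq C]
    (H : Matrix R C F) : ∃ G : Matrix C R F, H * G * H = H := by
  obtain ⟨g, hg⟩ := LinearMap.exists_rightInverse_of_surjective (Matrix.toLin' H).rangeRestrict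
    (LinearMap.range_rangeRestrict _)
  obtain ⟨G, hG⟩ := LinearMap.exists_extend g
  refine ⟨LinearMap.toMatrix' G, ?_⟩
  apply Matrix.toLin'.injective
  rw [Matrix.toLin'_mul, Matrix.toLin'_mul, Matrix.toLin'_toMatrix']
  refine LinearMap.ext fun v => ?_
  have h1 : G (Matrix.toLin' H v) = g ((Matrix.toLin' H).rangeRestrict v) :=
    LinearMap.congr_fun hG ((Matrix.toLin' H).rangeRestrict v)
  have h2 := congrArg Subtype.val (LinearMap.congr_fun hg ((Matrix.toLin' H).rangeRestrict v))
  rw [LinearMap.comp_apply, LinearMap.comp_apply, h1]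
  simpa using h2

variable {R₁ C₁ R₂ C₂ : Type*} [Fintype C₁] [Fintype C₂]

/-- Exactness in the middle of the product complex: a pair `(U, V)` with `H₁ U = V H₂` that is
orthogonal to the evident dual cycles is a boundary. -/
lemma exists_eq_mul_and_eq_mul [Fintype R₁] [Fintype R₂] (H₁ : Matrix R₁ C₁ F) (H₂ : Matrix R₂ C₂ F)
    (U : Matrix C₁ C₂ F) (V : Matrix R₁ R₂ F) (hUV : H₁ * U = V * H₂)
    (hU : ∀ b, H₂.mulVec b = 0 → U.mulVec b = 0)
    (hV : ∀ c, Matrix.vecMul c H₁ = 0 → Matrix.vecMul c V = 0) :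
    ∃ W : Matrix C₁ R₂ F, U = W * H₂ ∧ V = H₁ * W := by
  classical
  obtain ⟨G₁, h₁⟩ := exists_mul_mul_eq_self H₁
  obtain ⟨G₂, h₂⟩ := exists_mul_mul_eq_self H₂
  have hU' : U * G₂ * H₂ = U := by
    have h0 : U * (1 - G₂ * H₂) = 0 := by
      refine Matrix.ext_of_mulVec_single fun j => ?_
      rw [← Matrix.mulVec_mulVec, Matrix.zero_mulVec]
      apply hU
      rw [Matrix.mulVec_mulVec, Matrix.mul_sub, ← Matrix.mul_assoc, h₂, Matrix.mul_one, sub_self,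
        Matrix.zero_mulVec]
    rw [Matrix.mul_sub, Matrix.mul_one, ← Matrix.mul_assoc, sub_eq_zero] at h0
    exact h0.symm
  have hV' : H₁ * G₁ * V = V := by
    have h0 : (1 - H₁ * G₁) * V = 0 := by
      refine Matrix.ext_of_single_vecMul fun j => ?_
      rw [← Matrix.vecMul_vecMul, Matrix.vecMul_zero]
      apply hV
      rw [Matrix.vecMul_vecMul, Matrix.sub_mul, h₁, Matrix.one_mul, sub_self, Matrix.vecMul_zero]
    rw [Matrix.sub_mul, Matrix.one_mul, sub_eq_zero] at h0
    exact h0.symm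
  -- `U G₂` solves the first equation; the correction term is killed by `H₂`
  refine ⟨U * G₂ + G₁ * (V - H₁ * (U * G₂)), ?_, ?_⟩
  · rw [Matrix.add_mul, hU', Matrix.mul_assoc, Matrix.sub_mul, Matrix.mul_assoc H₁, hU', ← hUV,
      sub_self, Matrix.mul_zero, add_zero]
  · rw [Matrix.mul_add, Matrix.mul_sub, Matrix.mul_sub, ← Matrix.mul_assoc H₁ G₁ V, hV',
      ← Matrix.mul_assoc G₁ H₁, ← Matrix.mul_assoc H₁ (G₁ * H₁), ← Matrix.mul_assoc H₁ G₁ H₁, h₁]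
    abel

/-- A basis of `ker M`, as the columns of a matrix `P` together with the coordinate map `P'`. -/
lemma exists_kernel_matrix {R₁ C₁ : Type*} [Fintype C₁] [DecidableEq C₁] (M : Matrix R₁ C₁ F) :
    ∃ (P : Matrix C₁ (Fin (Module.finrank F (LinearMap.ker M.mulVecLin))) F)
      (P' : Matrix (Fin (Module.finrank F (LinearMap.ker M.mulVecLin))) C₁ F),
      P' * P = 1 ∧ M * P = 0 ∧ ∀ y, M.mulVec y = 0 → (P * P').mulVec y = y := by
  let b := Module.finBasis F (LinearMap.ker M.mulVecLin)
  let f : (Fin (Module.finrank F (LinearMap.ker M.mulVecLin)) → F) →ₗ[F] (C₁ → F) :=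
    (LinearMap.ker M.mulVecLin).subtype ∘ₗ b.equivFun.symm.toLinearMap
  have hf : LinearMap.ker f = ⊥ := by
    rw [LinearMap.ker_eq_bot]
    exact (Submodule.subtype_injective _).comp b.equivFun.symm.injective
  obtain ⟨g, hg⟩ := f.exists_leftInverse_of_injective hf
  refine ⟨LinearMap.toMatrix' f, LinearMap.toMatrix' g, ?_, ?_, ?_⟩
  · rw [← LinearMap.toMatrix'_comp, hg, LinearMap.toMatrix'_id]
  · refine Matrix.ext_of_mulVec_single fun j => ?_
    rw [← Matrix.mulVec_mulVec, Matrix.zero_mulVec, LinearMap.toMatrix'_mulVec]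
    exact (b.equivFun.symm (Pi.single j 1)).2
  · intro y hy
    have : f (b.equivFun ⟨y, hy⟩) = y := by simp [f]
    rw [← Matrix.mulVec_mulVec, LinearMap.toMatrix'_mulVec, LinearMap.toMatrix'_mulVec, ← this,
      ← LinearMap.comp_apply g f, hg, LinearMap.id_apply]

/-- The matrices with columns in `ker M` and rows in `ker N` form a tensor product of the two
kernels. -/
lemma finrank_eq_of_columns_rows_mem_ker [DecidableEq C₁] [DecidableEq C₂] (M : Matrix R₁ C₁ F)
    (N : Matrix R₂ C₂ F) (S : Submodule F (C₁ × C₂ → F))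
    (hS : ∀ y, y ∈ S ↔ M * Matrix.of (Function.curry y) = 0 ∧
      Matrix.of (Function.curry y) * N.transpose = 0) :
    Module.finrank F S = Module.finrank F (LinearMap.ker M.mulVecLin) *
      Module.finrank F (LinearMap.ker N.mulVecLin) := by
  obtain ⟨P, P', hP, hMP, hP'⟩ := exists_kernel_matrix M
  obtain ⟨T, T', hT, hNT, hT'⟩ := exists_kernel_matrix N
  let f : Matrix (Fin (Module.finrank F (LinearMap.ker M.mulVecLin)))
      (Fin (Module.finrank F (LinearMap.ker N.mulVecLin))) F →ₗ[F] (C₁ × C₂ → F) :=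
    { toFun := fun Z => Function.uncurry (P * Z * T.transpose)
      map_add' := fun Z Z' => by
        rw [Matrix.mul_add, Matrix.add_mul]; rfl
      map_smul' := fun c Z => by
        rw [Matrix.mul_smul, Matrix.smul_mul]; rfl }
  have hf : ∀ Z, Matrix.of (Function.curry (f Z)) = P * Z * T.transpose := fun Z => rfl
  have hinj : Function.Injective f := by
    intro Z Z' h
    have h1 : P * Z * T.transpose = P * Z' * T.transpose := by rw [← hf, ← hf, h]
    have h2 : ∀ Z : Matrix (Fin (Module.finrank F (LinearMap.ker M.mulVecLin)))
        (Fin (Module.finrank F (LinearMap.ker N.mulVecLin))) F, P' * (P * Z * T.transpose) * T'.transpose = Z := fun Z => by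
      rw [Matrix.mul_assoc P, ← Matrix.mul_assoc P', hP, Matrix.one_mul, Matrix.mul_assoc,
        ← Matrix.transpose_mul, hT, Matrix.transpose_one, Matrix.mul_one]
    rw [← h2 Z, h1, h2]
  have hrange : LinearMap.range f = S := by
    ext y
    rw [hS]
    constructor
    · rintro ⟨Z, rfl⟩
      rw [hf]
      constructor
      · rw [← Matrix.mul_assoc, ← Matrix.mul_assoc, hMP, Matrix.zero_mul, Matrix.zero_mul]
      · rw [Matrix.mul_assoc, ← Matrix.transpose_mul, hNT, Matrix.transpose_zero, Matrix.mul_zero]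
    · rintro ⟨h1, h2⟩
      set Y : Matrix C₁ C₂ F := Matrix.of (Function.curry y) with hY
      refine ⟨P' * Y * T'.transpose, ?_⟩
      have h3 : P * P' * Y = Y := by
        refine Matrix.ext_of_mulVec_single fun j => ?_
        rw [← Matrix.mulVec_mulVec]
        apply hP'
        rw [Matrix.mulVec_mulVec, h1, Matrix.zero_mulVec]
      have h4 : T * T' * Y.transpose = Y.transpose := by
        refine Matrix.ext_of_mulVec_single fun j => ?_
        rw [← Matrix.mulVec_mulVec]
        apply hT'
        rw [Matrix.mulVec_mulVec, ← Matrix.transpose_transpose N, ← Matrix.transpose_mul, h2,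
          Matrix.transpose_zero, Matrix.zero_mulVec]
      have h5 : Y * (T'.transpose * T.transpose) = Y := by
        rw [← Matrix.transpose_mul, ← Matrix.transpose_transpose Y, ← Matrix.transpose_mul, h4]
      have h6 : P * (P' * Y * T'.transpose) * T.transpose = Y := by
        rw [← Matrix.mul_assoc, ← Matrix.mul_assoc, h3, Matrix.mul_assoc, h5]
      show Function.uncurry (P * (P' * Y * T'.transpose) * T.transpose) = y
      rw [h6]
      rfl
  rw [← hrange, LinearMap.finrank_range_of_inj hinj, Module.finrank_matrix]
  simp

end MatrixEquations

/-! ### Hypergraph products -/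

section HypergraphProduct

variable {R₁ C₁ R₂ C₂ : Type*}

/-- The entries on the first block of qubits of a hypergraph product, as a matrix. -/
def leftBlock (u : (C₁ × C₂) ⊕ (R₁ × R₂) → ZMod 2) : Matrix C₁ C₂ (ZMod 2) :=
  Matrix.of fun i j => u (Sum.inl (i, j))

/-- The entries on the second block of qubits of a hypergraph product, as a matrix. -/
def rightBlock (u : (C₁ × C₂) ⊕ (R₁ × R₂) → ZMod 2) : Matrix R₁ R₂ (ZMod 2) :=
  Matrix.of fun i j => u (Sum.inr (i, j))

lemma eq_iff_blocks_eq {u v : (C₁ × C₂) ⊕ (R₁ × R₂) → ZMod 2} :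
    u = v ↔ leftBlock u = leftBlock v ∧ rightBlock u = rightBlock v := by
  simp [funext_iff, leftBlock, rightBlock]

/-- The `X`-check matrix of the hypergraph product. -/
def hgpX [DecidableEq R₁] [DecidableEq C₂] (H₁ : Matrix R₁ C₁ (ZMod 2))
    (H₂ : Matrix R₂ C₂ (ZMod 2)) : Matrix (R₁ × C₂) ((C₁ × C₂) ⊕ (R₁ × R₂)) (ZMod 2) :=
  Matrix.fromCols (H₁ ⊗ₖ (1 : Matrix C₂ C₂ (ZMod 2))) ((1 : Matrix R₁ R₁ (ZMod 2)) ⊗ₖ H₂.transpose)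

/-- The `Z`-check matrix of the hypergraph product. -/
def hgpZ [DecidableEq C₁] [DecidableEq R₂] (H₁ : Matrix R₁ C₁ (ZMod 2))
    (H₂ : Matrix R₂ C₂ (ZMod 2)) : Matrix (C₁ × R₂) ((C₁ × C₂) ⊕ (R₁ × R₂)) (ZMod 2) :=
  Matrix.fromCols ((1 : Matrix C₁ C₁ (ZMod 2)) ⊗ₖ H₂) (H₁.transpose ⊗ₖ (1 : Matrix R₂ R₂ (ZMod 2)))

section VecMul

variable (H₁ : Matrix R₁ C₁ (ZMod 2)) (H₂ : Matrix R₂ C₂ (ZMod 2))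

lemma leftBlock_vecMul_hgpX [DecidableEq R₁] [DecidableEq C₂] [Fintype R₁] [Fintype C₂]
    (a : R₁ × C₂ → ZMod 2) :
    leftBlock (Matrix.vecMul a (hgpX H₁ H₂)) = H₁.transpose * Matrix.of (Function.curry a) := by
  ext i j
  simp [hgpX, Matrix.vecMul, dotProduct, Fintype.sum_prod_type, Matrix.one_apply, leftBlock,
    Matrix.mul_apply, mul_comm]

lemma rightBlock_vecMul_hgpX [DecidableEq R₁] [DecidableEq C₂] [Fintype R₁] [Fintype C₂]
    (a : R₁ × C₂ → ZMod 2) :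
    rightBlock (Matrix.vecMul a (hgpX H₁ H₂)) = Matrix.of (Function.curry a) * H₂.transpose := by
  ext i j
  simp [hgpX, Matrix.vecMul, dotProduct, Fintype.sum_prod_type, Matrix.one_apply, rightBlock,
    Matrix.mul_apply, mul_comm]

lemma leftBlock_vecMul_hgpZ [DecidableEq C₁] [DecidableEq R₂] [Fintype C₁] [Fintype R₂]
    (a : C₁ × R₂ → ZMod 2) :
    leftBlock (Matrix.vecMul a (hgpZ H₁ H₂)) = Matrix.of (Function.curry a) * H₂ := by
  ext i j
  simp [hgpZ, Matrix.vecMul, dotProduct, Fintype.sum_prod_type, Matrix.one_apply, leftBlock,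
    Matrix.mul_apply, mul_comm]

lemma rightBlock_vecMul_hgpZ [DecidableEq C₁] [DecidableEq R₂] [Fintype C₁] [Fintype R₂]
    (a : C₁ × R₂ → ZMod 2) :
    rightBlock (Matrix.vecMul a (hgpZ H₁ H₂)) = H₁ * Matrix.of (Function.curry a) := by
  ext i j
  simp [hgpZ, Matrix.vecMul, dotProduct, Fintype.sum_prod_type, Matrix.one_apply, rightBlock,
    Matrix.mul_apply, mul_comm]

end VecMul

variable [Fintype R₁] [Fintype C₁] [Fintype R₂] [Fintype C₂]
variable [DecidableEq R₁] [DecidableEq C₁] [DecidableEq R₂] [DecidableEq C₂]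

omit [Fintype R₁] [Fintype C₁] [Fintype R₂] [Fintype C₂] in
lemma hypergraphProduct_eq (H₁ : Matrix R₁ C₁ (ZMod 2)) (H₂ : Matrix R₂ C₂ (ZMod 2)) :
    hypergraphProduct H₁ H₂ = cssCode (hgpX H₁ H₂) (hgpZ H₁ H₂) := rfl

variable {H₁ : Matrix R₁ C₁ (ZMod 2)} {H₂ : Matrix R₂ C₂ (ZMod 2)}

omit [DecidableEq C₁] [DecidableEq R₂] in
lemma hgpX_mulVec_eq_zero_iff (u : (C₁ × C₂) ⊕ (R₁ × R₂) → ZMod 2) :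
    (hgpX H₁ H₂).mulVec u = 0 ↔ H₁ * leftBlock u = rightBlock u * H₂ := by
  have h : Matrix.of (Function.curry ((hgpX H₁ H₂).mulVec u)) =
      H₁ * leftBlock u - rightBlock u * H₂ := by
    ext i j
    simp [hgpX, Matrix.mulVec, dotProduct, Fintype.sum_prod_type, Matrix.one_apply, leftBlock,
      rightBlock, Matrix.mul_apply, mul_comm, CharTwo.sub_eq_add]
  rw [← sub_eq_zero (a := H₁ * _), ← h, ← Matrix.ext_iff]
  simp [funext_iff]

omit [DecidableEq R₁] [DecidableEq C₂] in
/-- The equation is transposed so as to take the form of `hgpX_mulVec_eq_zero_iff` with `H₁` and `H₂`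
exchanged; `X`-type logical operators are thereby `Z`-type ones of the exchanged product. -/
lemma hgpZ_mulVec_eq_zero_iff (u : (C₁ × C₂) ⊕ (R₁ × R₂) → ZMod 2) :
    (hgpZ H₁ H₂).mulVec u = 0 ↔
      H₂ * (leftBlock u).transpose = (rightBlock u).transpose * H₁ := by
  have h : (Matrix.of (Function.curry ((hgpZ H₁ H₂).mulVec u))).transpose =
      H₂ * (leftBlock u).transpose - (rightBlock u).transpose * H₁ := by
    ext i j
    simp [hgpZ, Matrix.mulVec, dotProduct, Fintype.sum_prod_type, Matrix.one_apply, leftBlock,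
      rightBlock, Matrix.mul_apply, mul_comm, CharTwo.sub_eq_add]
  rw [← sub_eq_zero (a := H₂ * _), ← h, ← Matrix.ext_iff]
  simp only [funext_iff, Prod.forall]
  exact forall_comm

omit [Fintype C₁] [Fintype R₂] [DecidableEq C₁] [DecidableEq R₂] in
lemma eq_vecMul_hgpX_iff (u : (C₁ × C₂) ⊕ (R₁ × R₂) → ZMod 2) :
    (∃ a, u = Matrix.vecMul a (hgpX H₁ H₂)) ↔ ∃ W : Matrix C₂ R₁ (ZMod 2),
      (leftBlock u).transpose = W * H₁ ∧ (rightBlock u).transpose = H₂ * W := by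
  simp only [eq_iff_blocks_eq, leftBlock_vecMul_hgpX, rightBlock_vecMul_hgpX]
  constructor
  · rintro ⟨a, h1, h2⟩
    refine ⟨(Matrix.of (Function.curry a)).transpose, ?_, ?_⟩ <;>
      simp only [h1, h2, Matrix.transpose_mul, Matrix.transpose_transpose]
  · rintro ⟨W, h1, h2⟩
    refine ⟨Function.uncurry W.transpose, ?_, ?_⟩
    · rw [← Matrix.transpose_transpose (leftBlock u), h1, Matrix.transpose_mul]; rfl
    · rw [← Matrix.transpose_transpose (rightBlock u), h2, Matrix.transpose_mul]; rfl

omit [Fintype R₁] [Fintype C₂] [DecidableEq R₁] [DecidableEq C₂] in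
lemma eq_vecMul_hgpZ_iff (u : (C₁ × C₂) ⊕ (R₁ × R₂) → ZMod 2) :
    (∃ b, u = Matrix.vecMul b (hgpZ H₁ H₂)) ↔ ∃ W : Matrix C₁ R₂ (ZMod 2),
      leftBlock u = W * H₂ ∧ rightBlock u = H₁ * W := by
  simp only [eq_iff_blocks_eq, leftBlock_vecMul_hgpZ, rightBlock_vecMul_hgpZ]
  exact ⟨fun ⟨a, h⟩ => ⟨_, h⟩, fun ⟨W, h⟩ => ⟨Function.uncurry W, h⟩⟩

lemma hgpX_mul_hgpZ_transpose : hgpX H₁ H₂ * (hgpZ H₁ H₂).transpose = 0 := by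
  -- a boundary `(W H₂, H₁ W)` is a cycle by associativity
  refine Matrix.ext_of_mulVec_single fun j => ?_
  rw [← Matrix.mulVec_mulVec, Matrix.zero_mulVec, Matrix.mulVec_transpose,
    hgpX_mulVec_eq_zero_iff, leftBlock_vecMul_hgpZ, rightBlock_vecMul_hgpZ, Matrix.mul_assoc]

lemma rank_add_finrank_ker {R C : Type*} [Fintype C] (H : Matrix R C (ZMod 2)) :
    H.rank + Module.finrank (ZMod 2) (LinearMap.ker H.mulVecLin) = Fintype.card C := by
  rw [Matrix.rank, LinearMap.finrank_range_add_finrank_ker, Module.finrank_fintype_fun_eq_card]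

omit [DecidableEq C₁] [DecidableEq R₂] in
lemma rank_hgpX : (hgpX H₁ H₂).rank + Module.finrank (ZMod 2) (LinearMap.ker H₁.transpose.mulVecLin)
    * Module.finrank (ZMod 2) (LinearMap.ker H₂.mulVecLin) =
      Fintype.card R₁ * Fintype.card C₂ := by
  rw [← Matrix.rank_transpose, ← Fintype.card_prod, ← rank_add_finrank_ker (hgpX H₁ H₂).transpose]
  congr 1
  refine (finrank_eq_of_columns_rows_mem_ker H₁.transpose H₂ _ fun y => ?_).symm
  rw [LinearMap.mem_ker, Matrix.mulVecLin_apply, Matrix.mulVec_transpose, eq_iff_blocks_eq,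
    leftBlock_vecMul_hgpX, rightBlock_vecMul_hgpX]
  rfl

omit [DecidableEq R₁] [DecidableEq C₂] in
lemma rank_hgpZ : (hgpZ H₁ H₂).rank + Module.finrank (ZMod 2) (LinearMap.ker H₁.mulVecLin)
    * Module.finrank (ZMod 2) (LinearMap.ker H₂.transpose.mulVecLin) =
      Fintype.card C₁ * Fintype.card R₂ := by
  rw [← Matrix.rank_transpose, ← Fintype.card_prod, ← rank_add_finrank_ker (hgpZ H₁ H₂).transpose]
  congr 1
  refine (finrank_eq_of_columns_rows_mem_ker H₁ H₂.transpose _ fun y => ?_).symm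
  rw [LinearMap.mem_ker, Matrix.mulVecLin_apply, Matrix.mulVec_transpose, eq_iff_blocks_eq,
    leftBlock_vecMul_hgpZ, rightBlock_vecMul_hgpZ, and_comm]
  rfl

/-- The Künneth formula for the number of logical qubits of a hypergraph product. -/
lemma finrank_codeSpace_hypergraphProduct : Module.finrank ℂ (codeSpace (hypergraphProduct H₁ H₂)) =
    2 ^ (Module.finrank (ZMod 2) (LinearMap.ker H₁.mulVecLin) *
        Module.finrank (ZMod 2) (LinearMap.ker H₂.mulVecLin) +
      Module.finrank (ZMod 2) (LinearMap.ker H₁.transpose.mulVecLin) *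
        Module.finrank (ZMod 2) (LinearMap.ker H₂.transpose.mulVecLin)) := by
  rw [hypergraphProduct_eq]
  apply finrank_codeSpace_cssCode hgpX_mul_hgpZ_transpose
  have hX := rank_hgpX (H₁ := H₁) (H₂ := H₂)
  have hZ := rank_hgpZ (H₁ := H₁) (H₂ := H₂)
  have h1 := rank_add_finrank_ker H₁
  have h1' := rank_add_finrank_ker H₁.transpose
  have h2 := rank_add_finrank_ker H₂
  have h2' := rank_add_finrank_ker H₂.transpose
  rw [Matrix.rank_transpose] at h1' h2'
  rw [Fintype.card_sum, Fintype.card_prod, Fintype.card_prod]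
  rw [← h1', ← h2] at hX
  rw [← h1, ← h2'] at hZ
  rw [← h1, ← h2, ← h1', ← h2']
  linarith

/-- A Pauli string has at least the weight of a vector `a` whose support lies in the projection of
its own support. -/
lemma hammingNorm_le_weight {X Y Q : Type*} [Fintype X] [Finite Q] (a : X → ZMod 2)
    (p : PauliString Q) (e : X × Y → Q) (he : Function.Injective e)
    (h : ∀ x, a x ≠ 0 → ∃ y, p.ActsOn (e (x, y))) : hammingNorm a ≤ p.weight := by
  classical
  choose f hf using h
  rw [hammingNorm, ← Fintype.card_subtype, ← Nat.card_eq_fintype_card, PauliString.weight,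
    ← Nat.card_coe_set_eq]
  refine Nat.card_le_card_of_injective
    (fun x : {x // a x ≠ 0} => (⟨e (x.1, f x.1 x.2), hf x.1 x.2⟩ : {q | p.ActsOn q})) ?_
  intro x x' h
  have := he (congrArg Subtype.val h)
  exact Subtype.ext (congrArg Prod.fst this)

/-- A Pauli string supported on a copy of the support of `a` has at most the weight of `a`. -/
lemma weight_le_hammingNorm {X Q : Type*} [Fintype X] (a : X → ZMod 2)
    (p : PauliString Q) (e : X → Q) (h : ∀ q, p.ActsOn q → ∃ x, a x ≠ 0 ∧ e x = q) :
    p.weight ≤ hammingNorm a := by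
  classical
  rw [hammingNorm, PauliString.weight, ← Set.ncard_coe_finset]
  refine le_trans (Set.ncard_le_ncard (t := e '' (Finset.univ.filter fun x => a x ≠ 0 : Finset X))
    ?_ ((Finset.finite_toSet _).image e)) (Set.ncard_image_le (Finset.finite_toSet _))
  intro q hq
  obtain ⟨x, hx, rfl⟩ := h q hq
  exact ⟨x, by simpa using hx, rfl⟩

omit [DecidableEq R₁] [DecidableEq C₁] [DecidableEq R₂] [DecidableEq C₂] in
/-- A nontrivial homology class of the product complex is detected by a codeword of one of the
factors; contracting the representative `(U, V)` with that codeword gives a codeword of the other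
factor. -/
lemma exists_codewords_of_not_boundary (H₁ : Matrix R₁ C₁ (ZMod 2)) (H₂ : Matrix R₂ C₂ (ZMod 2))
    (U : Matrix C₁ C₂ (ZMod 2)) (V : Matrix R₁ R₂ (ZMod 2)) (hUV : H₁ * U = V * H₂)
    (h : ¬ ∃ W : Matrix C₁ R₂ (ZMod 2), U = W * H₂ ∧ V = H₁ * W) :
    (∃ a b, H₁.mulVec a = 0 ∧ H₂.mulVec b = 0 ∧ a ≠ 0 ∧ b ≠ 0 ∧
      ∀ i, a i ≠ 0 → ∃ j, U i j ≠ 0) ∨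
    (∃ c d, H₁.transpose.mulVec c = 0 ∧ H₂.transpose.mulVec d = 0 ∧ c ≠ 0 ∧ d ≠ 0 ∧
      ∀ j, d j ≠ 0 → ∃ i, V i j ≠ 0) := by
  by_contra hcon
  rw [not_or] at hcon
  refine h (exists_eq_mul_and_eq_mul H₁ H₂ U V hUV ?_ ?_)
  · intro b hb
    by_contra hne
    refine hcon.1 ⟨U.mulVec b, b, ?_, hb, hne, ?_, ?_⟩
    · rw [Matrix.mulVec_mulVec, hUV, ← Matrix.mulVec_mulVec, hb, Matrix.mulVec_zero]
    · rintro rfl; simp at hne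
    · intro i hi
      by_contra! hz
      exact hi (by simp [Matrix.mulVec, dotProduct, hz])
  · intro c hc
    by_contra hne
    refine hcon.2 ⟨c, Matrix.vecMul c V, ?_, ?_, ?_, hne, ?_⟩
    · rw [Matrix.mulVec_transpose, hc]
    · rw [Matrix.mulVec_transpose, Matrix.vecMul_vecMul, ← hUV, ← Matrix.vecMul_vecMul, hc,
        Matrix.zero_vecMul]
    · rintro rfl; simp at hne
    · intro i hi
      by_contra! hz
      exact hi (by simp [Matrix.vecMul, dotProduct, hz])

/-- Every nontrivial logical operator of a hypergraph product has at least the weight of a nonzero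
codeword of one of the factors or of their transposes. -/
lemma le_distance_hypergraphProduct {d : ℕ∞}
    (h : ∀ a b, H₁.mulVec a = 0 → H₂.mulVec b = 0 → a ≠ 0 → b ≠ 0 →
      d ≤ hammingNorm a ∧ d ≤ hammingNorm b)
    (h' : ∀ a b, H₁.transpose.mulVec a = 0 → H₂.transpose.mulVec b = 0 → a ≠ 0 → b ≠ 0 →
      d ≤ hammingNorm a ∧ d ≤ hammingNorm b) :
    d ≤ distance (hypergraphProduct H₁ H₂) := by
  refine le_iInf₂ fun p hp => ?_
  rw [hypergraphProduct_eq, Set.mem_ofPred_eq,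
    isNontrivialLogical_cssCode_iff hgpX_mul_hgpZ_transpose, hgpX_mulVec_eq_zero_iff,
    hgpZ_mulVec_eq_zero_iff, eq_vecMul_hgpX_iff, eq_vecMul_hgpZ_iff] at hp
  obtain ⟨hz, hx, hx' | hz'⟩ := hp
  · obtain ⟨b, a, hb, ha, hb0, ha0, hab⟩ | ⟨c, b, hc, hb, hc0, hb0, hcb⟩ :=
      exists_codewords_of_not_boundary H₂ H₁ _ _ hx hx'
    · refine (h a b ha hb ha0 hb0).2.trans (Nat.cast_le.2 ?_)
      refine hammingNorm_le_weight b p (fun y : C₂ × C₁ => Sum.inl y.swap)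
        (Sum.inl_injective.comp Prod.swap_injective) fun j hj => ?_
      exact (hab j hj).imp fun i hi => Or.inl hi
    · refine (h' b c hb hc hb0 hc0).1.trans (Nat.cast_le.2 ?_)
      refine hammingNorm_le_weight b p (fun y : R₁ × R₂ => Sum.inr y) Sum.inr_injective
        fun j hj => ?_
      exact (hcb j hj).imp fun i hi => Or.inl hi
  · obtain ⟨a, b, ha, hb, ha0, hb0, hab⟩ | ⟨c, b, hc, hb, hc0, hb0, hcb⟩ :=
      exists_codewords_of_not_boundary H₁ H₂ _ _ hz hz'
    · refine (h a b ha hb ha0 hb0).1.trans (Nat.cast_le.2 ?_)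
      refine hammingNorm_le_weight a p (fun y : C₁ × C₂ => Sum.inl y) Sum.inl_injective
        fun j hj => ?_
      exact (hab j hj).imp fun i hi => Or.inr hi
    · refine (h' c b hc hb hc0 hb0).2.trans (Nat.cast_le.2 ?_)
      refine hammingNorm_le_weight b p (fun y : R₂ × R₁ => Sum.inr y.swap)
        (Sum.inr_injective.comp Prod.swap_injective) fun j hj => ?_
      exact (hcb j hj).imp fun i hi => Or.inr hi

/-- A codeword of `H₁` in a single column, through a position `j` where some codeword of `H₂` does
not vanish, is a nontrivial `Z`-type logical operator. -/
lemma distance_hypergraphProduct_le_left {b : C₂ → ZMod 2} (hb : H₂.mulVec b = 0) (hb0 : b ≠ 0) :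
    distance (hypergraphProduct H₁ H₂) ≤ classicalDistance H₁ := by
  refine le_iInf₂ fun a ⟨ha, ha0⟩ => ?_
  obtain ⟨j, hj⟩ := Function.ne_iff.1 hb0
  obtain ⟨i, hi⟩ := Function.ne_iff.1 ha0
  let p : PauliString ((C₁ × C₂) ⊕ (R₁ × R₂)) :=
    ⟨0, Sum.elim (Function.uncurry (Matrix.vecMulVec a (Pi.single j 1))) 0⟩
  have hl : leftBlock p.z = Matrix.vecMulVec a (Pi.single j 1) := rfl
  have hr : rightBlock p.z = 0 := rfl
  have hp : IsNontrivialLogical (hypergraphProduct H₁ H₂) p := by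
    rw [hypergraphProduct_eq, isNontrivialLogical_cssCode_iff hgpX_mul_hgpZ_transpose,
      hgpX_mulVec_eq_zero_iff, eq_vecMul_hgpZ_iff, hl, hr]
    refine ⟨?_, Matrix.mulVec_zero _, Or.inr ?_⟩
    · rw [Matrix.mul_vecMulVec, ha, Matrix.zero_mul]
      ext; simp [Matrix.vecMulVec]
    · rintro ⟨W, hW, -⟩
      have h1 : (Matrix.vecMulVec a (Pi.single j 1)).mulVec b = 0 := by
        rw [hW, ← Matrix.mulVec_mulVec, hb, Matrix.mulVec_zero]
      have h2 := congrFun h1 i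
      simp only [Matrix.mulVec, dotProduct, Matrix.vecMulVec_apply, Pi.single_apply] at h2
      simp at h2
      exact h2.elim hi hj
  refine (iInf₂_le p hp).trans (Nat.cast_le.2 ?_)
  refine weight_le_hammingNorm a p (fun i => Sum.inl (i, j)) ?_
  rintro (⟨i', j'⟩ | q) hq
  · have hq : a i' * (Pi.single j 1 : C₂ → ZMod 2) j' ≠ 0 := hq.resolve_left fun h => h rfl
    have hj' : j' = j := by
      by_contra hne
      exact hq (by rw [Pi.single_eq_of_ne hne, mul_zero])
    exact ⟨i', left_ne_zero_of_mul hq, by rw [hj']⟩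
  · exact (hq.elim (fun h => h rfl) fun h => h rfl).elim

/-- A codeword of `H₂` in a single row, through a position `i` where some codeword of `H₁` does
not vanish, is a nontrivial `X`-type logical operator. -/
lemma distance_hypergraphProduct_le_right {a : C₁ → ZMod 2} (ha : H₁.mulVec a = 0) (ha0 : a ≠ 0) :
    distance (hypergraphProduct H₁ H₂) ≤ classicalDistance H₂ := by
  refine le_iInf₂ fun b ⟨hb, hb0⟩ => ?_
  obtain ⟨j, hj⟩ := Function.ne_iff.1 hb0
  obtain ⟨i, hi⟩ := Function.ne_iff.1 ha0
  let p : PauliString ((C₁ × C₂) ⊕ (R₁ × R₂)) :=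
    ⟨Sum.elim (Function.uncurry (Matrix.vecMulVec (Pi.single i 1) b)) 0, 0⟩
  have hl : (leftBlock p.x).transpose = Matrix.vecMulVec b (Pi.single i 1) :=
    Matrix.transpose_vecMulVec (Pi.single i 1) b
  have hr : (rightBlock p.x).transpose = 0 := rfl
  have hp : IsNontrivialLogical (hypergraphProduct H₁ H₂) p := by
    rw [hypergraphProduct_eq, isNontrivialLogical_cssCode_iff hgpX_mul_hgpZ_transpose,
      hgpZ_mulVec_eq_zero_iff, eq_vecMul_hgpX_iff, hl, hr]
    refine ⟨Matrix.mulVec_zero _, ?_, Or.inl ?_⟩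
    · rw [Matrix.mul_vecMulVec, hb, Matrix.zero_mul]
      ext; simp [Matrix.vecMulVec]
    · rintro ⟨W, hW, -⟩
      have h1 : (Matrix.vecMulVec b (Pi.single i 1)).mulVec a = 0 := by
        rw [hW, ← Matrix.mulVec_mulVec, ha, Matrix.mulVec_zero]
      have h2 := congrFun h1 j
      simp only [Matrix.mulVec, dotProduct, Matrix.vecMulVec_apply, Pi.single_apply] at h2
      simp at h2
      exact h2.elim hj hi
  refine (iInf₂_le p hp).trans (Nat.cast_le.2 ?_)
  refine weight_le_hammingNorm b p (fun j => Sum.inl (i, j)) ?_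
  rintro (⟨i', j'⟩ | q) hq
  · have hq : (Pi.single i 1 : C₁ → ZMod 2) i' * b j' ≠ 0 := hq.resolve_right fun h => h rfl
    have hi' : i' = i := by
      by_contra hne
      exact hq (by rw [Pi.single_eq_of_ne hne, zero_mul])
    exact ⟨j', right_ne_zero_of_mul hq, by rw [hi']⟩
  · exact (hq.elim (fun h => h rfl) fun h => h rfl).elim

lemma hypergraphProduct_hasParameters {k : ℕ} {d : ℕ∞}
    (hk : Module.finrank (ZMod 2) (LinearMap.ker H₁.mulVecLin) *
        Module.finrank (ZMod 2) (LinearMap.ker H₂.mulVecLin) +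
      Module.finrank (ZMod 2) (LinearMap.ker H₁.transpose.mulVecLin) *
        Module.finrank (ZMod 2) (LinearMap.ker H₂.transpose.mulVecLin) = k)
    (hd : distance (hypergraphProduct H₁ H₂) = d) :
    HasParameters (hypergraphProduct H₁ H₂)
      (Fintype.card C₁ * Fintype.card C₂ + Fintype.card R₁ * Fintype.card R₂) k d where
  isStabilizerCode := isStabilizerCode_cssCode hgpX_mul_hgpZ_transpose
  physical := by simp
  logical := by rw [finrank_codeSpace_hypergraphProduct, hk]
  distance_eq := hd

end HypergraphProduct

/-! ### Circulant matrices and their truncations -/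

lemma cyclicShift_pow_apply (n s : ℕ) (i j : Fin n) :
    (cyclicShift n ^ s) i j = if (i : ℕ) = ((j : ℕ) + s) % n then 1 else 0 := by
  induction s generalizing j with
  | zero =>
    simp [Matrix.one_apply, Nat.mod_eq_of_lt j.2, Fin.ext_iff]
  | succ s ih =>
    have hn : 0 < n := i.pos
    let j' : Fin n := ⟨((j : ℕ) + 1) % n, Nat.mod_lt _ hn⟩
    have hS : ∀ k, cyclicShift n k j = if k = j' then 1 else 0 := fun k => by
      simp [cyclicShift, j', Fin.ext_iff]
    rw [pow_succ, Matrix.mul_apply]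
    simp only [hS, mul_ite, mul_one, mul_zero, Finset.sum_ite_eq', Finset.mem_univ, if_true, ih, j',
      Nat.mod_add_mod]
    congr 2
    ring_nf

lemma cyclicShift_pow_self (n : ℕ) : cyclicShift n ^ n = 1 := by
  ext i j
  simp [cyclicShift_pow_apply, Matrix.one_apply, Nat.mod_eq_of_lt j.2, Fin.ext_iff]

lemma circulantOf_apply (n : ℕ) (h : (ZMod 2)[X]) (i j : Fin n) :
    circulantOf n h i j = ∑ s ∈ Finset.range (h.natDegree + 1),
      if (i : ℕ) = ((j : ℕ) + s) % n then h.coeff s else 0 := by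
  rw [circulantOf, aeval_eq_sum_range, Matrix.sum_apply]
  simp [cyclicShift_pow_apply]

lemma exists_of_circulantOf_ne_zero {n : ℕ} {h : (ZMod 2)[X]} {i j : Fin n}
    (hij : circulantOf n h i j ≠ 0) : ∃ s, h.coeff s ≠ 0 ∧ (i : ℕ) = ((j : ℕ) + s) % n := by
  rw [circulantOf_apply] at hij
  obtain ⟨s, -, hs⟩ := Finset.exists_ne_zero_of_sum_ne_zero hij
  rw [ne_eq, ite_eq_right_iff, Classical.not_imp] at hs
  exact ⟨s, hs.2, hs.1⟩

/-- Reversing the order of the coordinates transposes a circulant matrix. -/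
lemma circulantOf_transpose_apply (n : ℕ) (h : (ZMod 2)[X]) (i j : Fin n) :
    circulantOf n h j i = circulantOf n h i.rev j.rev := by
  rw [circulantOf_apply, circulantOf_apply]
  refine Finset.sum_congr rfl fun s _ => if_congr ?_ rfl rfl
  have key : ∀ a b t : ℕ, a < n → (a = (b + t) % n ↔ (n : ℤ) ∣ b + t - a) := by
    intro a b t ha
    nth_rewrite 1 [← Nat.mod_eq_of_lt ha]
    change Nat.ModEq n a (b + t) ↔ _
    rw [Nat.modEq_iff_dvd]
    push_cast
    rfl
  rw [key _ _ _ j.2, key _ _ _ i.rev.2, Fin.val_rev, Fin.val_rev]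
  have hi := i.2
  have hj := j.2
  rw [show ((n - (j + 1) : ℕ) : ℤ) + s - ((n - (i + 1) : ℕ) : ℤ) = (i : ℤ) + s - j by omega]

lemma circulantOf_transpose (n : ℕ) (h : (ZMod 2)[X]) :
    (circulantOf n h).transpose = (circulantOf n h).submatrix Fin.revPerm Fin.revPerm := by
  ext i j
  exact circulantOf_transpose_apply n h i j

/-- The rows of `A_red` do not wrap around: they are translates of the coefficient vector of `A`. -/
lemma redA_apply (n : ℕ) (h : (ZMod 2)[X]) (i : KeptRow n h.natDegree) (j : Fin n) :
    redA n h i j = if (j : ℕ) ≤ (i : Fin n) then h.coeff ((i : Fin n) - j) else 0 := by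
  obtain ⟨i, hi⟩ := i
  have hin := i.2
  have hjn := j.2
  have hcond : ∀ s ∈ Finset.range (h.natDegree + 1),
      ((if (i : ℕ) = ((j : ℕ) + s) % n then h.coeff s else 0) =
        if s = (i : ℕ) - j then (if (j : ℕ) ≤ i then h.coeff ((i : ℕ) - j) else 0) else 0) := by
    intro s hs
    have hs' : s ≤ h.natDegree := Nat.lt_succ_iff.1 (Finset.mem_range.1 hs)
    have hmod : (i : ℕ) = ((j : ℕ) + s) % n ↔ (i : ℕ) = j + s := by
      rcases lt_or_ge ((j : ℕ) + s) n with hlt | hge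
      · rw [Nat.mod_eq_of_lt hlt]
      · rw [Nat.mod_eq_sub_mod hge, Nat.mod_eq_of_lt (by omega)]
        omega
    rw [if_congr hmod rfl rfl]
    by_cases h1 : (i : ℕ) = j + s
    · rw [if_pos h1, if_pos (by omega), if_pos (by omega)]
      congr 1
      omega
    · rw [if_neg h1]
      split_ifs <;> first | rfl | omega
  show circulantOf n h i j = if (j : ℕ) ≤ i then h.coeff ((i : ℕ) - j) else 0
  rw [circulantOf_apply, Finset.sum_congr rfl hcond, Finset.sum_ite_eq']
  split_ifs with h1 h2 h2
  · rfl
  · rfl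
  · rw [Finset.mem_range] at h1
    exact (coeff_eq_zero_of_natDegree_lt (by omega)).symm
  · rfl

/-- The rows of `A_red` are linearly independent: each begins with the leading coefficient of `A`,
one column to the right of the previous one. -/
lemma eq_zero_of_redA_transpose_mulVec_eq_zero {n : ℕ} {h : (ZMod 2)[X]} (h0 : h ≠ 0)
    {c : KeptRow n h.natDegree → ZMod 2} (hc : (redA n h).transpose.mulVec c = 0) : c = 0 := by
  have key : ∀ N : ℕ, ∀ i : KeptRow n h.natDegree, ((i : Fin n) : ℕ) = N → c i = 0 := by
    intro N
    induction N using Nat.strong_induction_on with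
    | _ N ih =>
      intro i hi
      have hri := i.2
      have hin := (i : Fin n).2
      -- row `i` begins in column `j`, where the rows below it vanish
      let j : Fin n := ⟨(i : Fin n) - h.natDegree, by omega⟩
      have hj := congrFun hc j
      simp only [Matrix.mulVec, dotProduct, Matrix.transpose_apply, Pi.zero_apply] at hj
      rw [Finset.sum_eq_single i] at hj
      · rw [redA_apply, if_pos (by simp [j])] at hj
        have h1 : ((i : Fin n) : ℕ) - j = h.natDegree := by simp only [j]; omega
        rw [h1, mul_eq_zero] at hj
        exact hj.resolve_left (by simpa using h0)
      · intro i' _ hne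
        rcases lt_trichotomy ((i' : Fin n) : ℕ) (i : Fin n) with hlt | heq | hgt
        · rw [ih _ (hi ▸ hlt) i' rfl, mul_zero]
        · exact absurd (Subtype.ext (Fin.ext heq)) hne
        · rw [redA_apply, coeff_eq_zero_of_natDegree_lt (by simp only [j]; omega)]
          simp
      · simp
  funext i
  exact key _ i rfl

lemma card_keptRow {n r : ℕ} (hr : r ≤ n) : Fintype.card (KeptRow n r) = n - r := by
  change Fintype.card {i : Fin n // r ≤ (i : ℕ)} = n - r
  have h1 : Fintype.card {i : Fin n // r ≤ (i : ℕ)} + Fintype.card {i : Fin n // ¬ r ≤ (i : ℕ)} = n := by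
    rw [Fintype.card_subtype_compl, Fintype.card_fin]
    have := Fintype.card_subtype_le (fun i : Fin n => r ≤ (i : ℕ))
    rw [Fintype.card_fin] at this
    omega
  have h2 : Fintype.card {i : Fin n // ¬ r ≤ (i : ℕ)} = r := by
    rw [Fintype.card_congr (β := Fin r)]
    · simp
    · exact
        { toFun := fun i => ⟨i.1, not_le.1 i.2⟩
          invFun := fun i => ⟨⟨i, i.2.trans_le hr⟩, not_le.2 i.2⟩
          left_inv := fun _ => rfl
          right_inv := fun _ => rfl }
  omega

section Divisor

variable {n : ℕ} {h : (ZMod 2)[X]}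

lemma X_pow_sub_one_ne_zero (hn : 0 < n) : (X ^ n - 1 : (ZMod 2)[X]) ≠ 0 := by
  simpa using X_pow_sub_C_ne_zero hn (1 : ZMod 2)

lemma natDegree_le_of_dvd_X_pow_sub_one (hn : 0 < n) (hdvd : h ∣ X ^ n - 1) : h.natDegree ≤ n := by
  have := natDegree_le_of_dvd hdvd (X_pow_sub_one_ne_zero hn)
  rwa [← C_1, natDegree_X_pow_sub_C] at this

lemma ker_transpose_eq_bot_redA (h0 : h ≠ 0) :
    LinearMap.ker (redA n h).transpose.mulVecLin = ⊥ :=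
  (Submodule.eq_bot_iff _).2 fun _ hc => eq_zero_of_redA_transpose_mulVec_eq_zero h0 hc

lemma finrank_ker_redA (h0 : h ≠ 0) (hdeg : h.natDegree ≤ n) :
    Module.finrank (ZMod 2) (LinearMap.ker (redA n h).mulVecLin) = h.natDegree := by
  have h1 := rank_add_finrank_ker (redA n h)
  have h2 := rank_add_finrank_ker (redA n h).transpose
  rw [ker_transpose_eq_bot_redA h0, Matrix.rank_transpose, finrank_bot, card_keptRow hdeg] at h2
  rw [Fintype.card_fin] at h1
  omega

lemma ker_circulantOf_le : LinearMap.ker (circulantOf n h).mulVecLin ≤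
    LinearMap.ker (redA n h).mulVecLin := by
  intro v hv
  rw [LinearMap.mem_ker, Matrix.mulVecLin_apply] at hv ⊢
  funext i
  exact congrFun hv i

/-- Both estimates come from counting degrees: at most `deg h` dimensions are left by the
`n - deg h` rows of `A_red`, and the image of the circulant of `(x^n - 1) / h` lies in the
kernel. -/
lemma finrank_ker_circulantOf (hn : 0 < n) (hdvd : h ∣ X ^ n - 1) :
    Module.finrank (ZMod 2) (LinearMap.ker (circulantOf n h).mulVecLin) = h.natDegree := by
  have hle : ∀ g : (ZMod 2)[X], g ∣ X ^ n - 1 →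
      Module.finrank (ZMod 2) (LinearMap.ker (circulantOf n g).mulVecLin) ≤ g.natDegree := by
    intro g hg
    rw [← finrank_ker_redA (ne_zero_of_dvd_ne_zero (X_pow_sub_one_ne_zero hn) hg)
      (natDegree_le_of_dvd_X_pow_sub_one hn hg)]
    exact Submodule.finrank_mono ker_circulantOf_le
  refine le_antisymm (hle h hdvd) ?_
  obtain ⟨g, hg⟩ := hdvd
  have hne : h * g ≠ 0 := hg ▸ X_pow_sub_one_ne_zero hn
  have hdeg : h.natDegree + g.natDegree = n := by
    rw [← natDegree_mul (left_ne_zero_of_mul hne) (right_ne_zero_of_mul hne), ← hg, ← C_1,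
      natDegree_X_pow_sub_C]
  -- `h g = x^n - 1` is annihilated by the shift, which has order dividing `n`
  have hmul : circulantOf n h * circulantOf n g = 0 := by
    rw [circulantOf, circulantOf, ← map_mul, ← hg]
    simp [cyclicShift_pow_self]
  have h1 := rank_add_finrank_ker (circulantOf n g)
  have h2 := hle g (hg ▸ dvd_mul_left g h)
  have h3 : (circulantOf n g).rank ≤
      Module.finrank (ZMod 2) (LinearMap.ker (circulantOf n h).mulVecLin) := by
    apply Submodule.finrank_mono
    rintro _ ⟨v, rfl⟩
    rw [LinearMap.mem_ker, Matrix.mulVecLin_apply, Matrix.mulVecLin_apply, Matrix.mulVec_mulVec,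
      hmul, Matrix.zero_mulVec]
  rw [Fintype.card_fin] at h1
  omega

/-- Deleting the first `deg h` rows does not change the code. -/
lemma classicalDistance_redA (hn : 0 < n) (hdvd : h ∣ X ^ n - 1) :
    classicalDistance (redA n h) = classicalDistance (circulantOf n h) := by
  have hker : LinearMap.ker (circulantOf n h).mulVecLin = LinearMap.ker (redA n h).mulVecLin := by
    apply Submodule.eq_of_le_of_finrank_eq ker_circulantOf_le
    rw [finrank_ker_circulantOf hn hdvd,
      finrank_ker_redA (ne_zero_of_dvd_ne_zero (X_pow_sub_one_ne_zero hn) hdvd)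
      (natDegree_le_of_dvd_X_pow_sub_one hn hdvd)]
  have hiff : ∀ v, (redA n h).mulVec v = 0 ↔ (circulantOf n h).mulVec v = 0 := fun v => by
    rw [← Matrix.mulVecLin_apply, ← Matrix.mulVecLin_apply, ← LinearMap.mem_ker,
      ← LinearMap.mem_ker, hker]
  simp only [classicalDistance, hiff]

end Divisor

section Reindex

variable {R C R' C' : Type*} [Fintype C] [Fintype C']

lemma classicalDistance_submatrix_le (H : Matrix R C (ZMod 2)) (e : R' ≃ R) (f : C' ≃ C) :
    classicalDistance (H.submatrix e f) ≤ classicalDistance H := by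
  refine le_iInf₂ fun v ⟨hv, hv0⟩ => ?_
  have hmem : (H.submatrix e f).mulVec (v ∘ f) = 0 := by
    rw [Matrix.submatrix_mulVec_equiv, Function.comp_assoc, Equiv.self_comp_symm,
      Function.comp_id, hv]
    rfl
  have hne : v ∘ f ≠ 0 := fun h => hv0 (by
    funext c
    simpa using congrFun h (f.symm c))
  refine (iInf₂_le (v ∘ f) ⟨hmem, hne⟩).trans (Nat.cast_le.2 (le_of_eq ?_))
  rw [hammingNorm, hammingNorm]
  exact Finset.card_equiv f (by simp)

lemma classicalDistance_submatrix (H : Matrix R C (ZMod 2)) (e : R' ≃ R) (f : C' ≃ C) :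
    classicalDistance (H.submatrix e f) = classicalDistance H := by
  refine le_antisymm (classicalDistance_submatrix_le H e f) ?_
  have hH : H = (H.submatrix e f).submatrix e.symm f.symm := by simp
  conv_lhs => rw [hH]
  exact classicalDistance_submatrix_le _ _ _

lemma finrank_ker_submatrix [Fintype R] [Fintype R'] (H : Matrix R C (ZMod 2)) (e : R' ≃ R)
    (f : C' ≃ C) :
    Module.finrank (ZMod 2) (LinearMap.ker (H.submatrix e f).mulVecLin) =
      Module.finrank (ZMod 2) (LinearMap.ker H.mulVecLin) := by
  have h1 := rank_add_finrank_ker H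
  have h2 := rank_add_finrank_ker (H.submatrix e f)
  rw [Matrix.rank_submatrix, Fintype.card_congr f] at h2
  omega

end Reindex

/-- Reversal exchanges the first rows with the last columns. -/
def keptColEquivKeptRow (n r : ℕ) : KeptCol n r ≃ KeptRow n r :=
  Fin.revPerm.subtypeEquiv fun j => by
    have := j.2
    simp only [Fin.revPerm_apply, Fin.val_rev]
    omega

/-- `B_redᵀ` is `A_red` for `A = B`, up to reversal of rows and columns. -/
lemma redB_transpose (n : ℕ) (h : (ZMod 2)[X]) :
    (redB n h).transpose = (redA n h).submatrix (keptColEquivKeptRow n h.natDegree) Fin.revPerm := by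
  ext j i
  exact circulantOf_transpose_apply n h j i

/-! ### The bicycle code as a hypergraph product -/

lemma coeff_aeval_X (i : Fin 2) (P : (ZMod 2)[X]) (e : Fin 2 →₀ ℕ) :
    (aeval (MvPolynomial.X i : MvPolynomial (Fin 2) (ZMod 2)) P).coeff e =
      if e = Finsupp.single i (e i) then P.coeff (e i) else 0 := by
  induction P using Polynomial.induction_on' with
  | add p q hp hq =>
    rw [map_add, MvPolynomial.coeff_add, hp, hq, coeff_add]
    split_ifs <;> simp
  | monomial n a =>
    rw [aeval_monomial, MvPolynomial.algebraMap_eq, MvPolynomial.coeff_C_mul,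
      MvPolynomial.coeff_X_pow, coeff_monomial]
    by_cases h : Finsupp.single i n = e
    · subst h
      simp
    · rw [if_neg h, mul_zero]
      split_ifs with h1 h2
      · exact absurd (h2 ▸ h1.symm) h
      · rfl
      · rfl

lemma coeff_aeval_X_single (i : Fin 2) (P : (ZMod 2)[X]) (s : ℕ) :
    (aeval (MvPolynomial.X i : MvPolynomial (Fin 2) (ZMod 2)) P).coeff (Finsupp.single i s) =
      P.coeff s := by
  simp [coeff_aeval_X]

lemma sum_support_aeval_X {M : Type*} [AddCommMonoid M] [Module (ZMod 2) M] (i : Fin 2)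
    (P : (ZMod 2)[X]) (g : (Fin 2 →₀ ℕ) → M) :
    ∑ e ∈ (aeval (MvPolynomial.X i : MvPolynomial (Fin 2) (ZMod 2)) P).support,
        (aeval (MvPolynomial.X i : MvPolynomial (Fin 2) (ZMod 2)) P).coeff e • g e =
      ∑ s ∈ Finset.range (P.natDegree + 1), P.coeff s • g (Finsupp.single i s) := by
  classical
  have hinj : Set.InjOn (fun s => Finsupp.single i s)
      (Finset.range (P.natDegree + 1) : Set ℕ) := (Finsupp.single_injective i).injOn
  have h1 : ∑ s ∈ Finset.range (P.natDegree + 1), P.coeff s • g (Finsupp.single i s) =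
      ∑ e ∈ (Finset.range (P.natDegree + 1)).image (fun s => Finsupp.single i s),
        (aeval (MvPolynomial.X i : MvPolynomial (Fin 2) (ZMod 2)) P).coeff e • g e := by
    rw [Finset.sum_image hinj]
    simp only [coeff_aeval_X_single]
  rw [h1]
  refine Finset.sum_subset (fun e he => ?_) fun e _ he => ?_
  · rw [MvPolynomial.mem_support_iff, coeff_aeval_X] at he
    rw [ne_eq, ite_eq_right_iff, Classical.not_imp] at he
    refine Finset.mem_image.2 ⟨e i, Finset.mem_range.2 ?_, he.1.symm⟩
    exact Nat.lt_succ_of_le (le_natDegree_of_ne_zero he.2)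
  · rw [MvPolynomial.notMem_support_iff.1 he, zero_smul]

lemma kronecker_one_pow {α β : Type*} [Fintype α] [Fintype β] [DecidableEq α] [DecidableEq β]
    (M : Matrix α α (ZMod 2)) (s : ℕ) :
    (M ⊗ₖ (1 : Matrix β β (ZMod 2))) ^ s = (M ^ s) ⊗ₖ (1 : Matrix β β (ZMod 2)) := by
  induction s with
  | zero => simp
  | succ s ih => rw [pow_succ, ih, ← Matrix.mul_kronecker_mul, pow_succ, Matrix.one_mul]

lemma one_kronecker_pow {α β : Type*} [Fintype α] [Fintype β] [DecidableEq α] [DecidableEq β]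
    (M : Matrix β β (ZMod 2)) (s : ℕ) :
    ((1 : Matrix α α (ZMod 2)) ⊗ₖ M) ^ s = (1 : Matrix α α (ZMod 2)) ⊗ₖ (M ^ s) := by
  induction s with
  | zero => simp
  | succ s ih => rw [pow_succ, ih, ← Matrix.mul_kronecker_mul, pow_succ, Matrix.one_mul]

lemma bivariateEval_inX (ℓ m : ℕ) (A : (ZMod 2)[X]) :
    bivariateEval ℓ m (inX A) = circulantOf ℓ A ⊗ₖ (1 : Matrix (Fin m) (Fin m) (ZMod 2)) := by
  rw [bivariateEval, inX, sum_support_aeval_X, circulantOf, aeval_eq_sum_range]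
  ext ⟨i, j⟩ ⟨i', j'⟩
  simp [Matrix.sum_apply, kronecker_one_pow, Finset.sum_mul, mul_assoc]

lemma bivariateEval_inY (ℓ m : ℕ) (B : (ZMod 2)[X]) :
    bivariateEval ℓ m (inY B) = (1 : Matrix (Fin ℓ) (Fin ℓ) (ZMod 2)) ⊗ₖ circulantOf m B := by
  rw [bivariateEval, inY, sum_support_aeval_X, circulantOf, aeval_eq_sum_range]
  ext ⟨i, j⟩ ⟨i', j'⟩
  simp [Matrix.sum_apply, one_kronecker_pow, Finset.mul_sum, mul_left_comm]

lemma parentCode_eq (ℓ m : ℕ) (A B : (ZMod 2)[X]) :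
    parentCode ℓ m A B = hypergraphProduct (circulantOf ℓ A) (circulantOf m B).transpose := by
  rw [parentCode, bivariateBicycle, hypergraphProduct, bivariateEval_inX, bivariateEval_inY,
    Matrix.transpose_transpose, ← Matrix.kroneckerMap_transpose, ← Matrix.kroneckerMap_transpose,
    Matrix.transpose_one, Matrix.transpose_one]

lemma isPrunedVersion_prunedCode (ℓ m : ℕ) (A B : (ZMod 2)[X]) :
    IsPrunedVersion (prunedCode ℓ m A B) (parentCode ℓ m A B) keepQubit keepCheck where
  isStabilizerCode := isStabilizerCode_cssCode hgpX_mul_hgpZ_transpose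
  qubit_injective := Function.Injective.sumMap Function.injective_id
    (Subtype.val_injective.prodMap Subtype.val_injective)
  check_injective := Function.Injective.sumMap
    (Subtype.val_injective.prodMap Function.injective_id)
    (Function.injective_id.prodMap Subtype.val_injective)
  restrict_x := by
    rw [parentCode_eq]
    rintro (⟨i, j⟩ | ⟨i, j⟩) (⟨i', j'⟩ | ⟨i', j'⟩) <;>
      simp [prunedCode, hypergraphProduct, cssCode, keepQubit, keepCheck, redA, redB,
        Matrix.one_apply, Subtype.ext_iff]
  restrict_z := by
    rw [parentCode_eq]
    rintro (⟨i, j⟩ | ⟨i, j⟩) (⟨i', j'⟩ | ⟨i', j'⟩) <;>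
      simp [prunedCode, hypergraphProduct, cssCode, keepQubit, keepCheck, redA, redB,
        Matrix.one_apply, Subtype.ext_iff]

/-! ### Parameters -/

section Parameters

variable {ℓ m n : ℕ} {A B h : (ZMod 2)[X]}

lemma exists_mulVec_eq_zero {R C : Type*} [Fintype C] {H : Matrix R C (ZMod 2)}
    (h : 0 < Module.finrank (ZMod 2) (LinearMap.ker H.mulVecLin)) :
    ∃ v, H.mulVec v = 0 ∧ v ≠ 0 := by
  obtain ⟨⟨v, hv⟩, hne⟩ := (Module.finrank_pos_iff_exists_ne_zero).1 h
  exact ⟨v, hv, fun h => hne (Subtype.ext h)⟩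

lemma eq_zero_of_finrank_ker_eq_zero {R C : Type*} [Fintype C] {H : Matrix R C (ZMod 2)}
    (h : Module.finrank (ZMod 2) (LinearMap.ker H.mulVecLin) = 0) {v : C → ZMod 2}
    (hv : H.mulVec v = 0) : v = 0 := by
  rw [Submodule.finrank_eq_zero] at h
  exact (Submodule.eq_bot_iff _).1 h v hv

lemma classicalDistance_le {R C : Type*} [Fintype C] {H : Matrix R C (ZMod 2)} {v : C → ZMod 2}
    (hv : H.mulVec v = 0) (h0 : v ≠ 0) : classicalDistance H ≤ hammingNorm v :=
  iInf₂_le v ⟨hv, h0⟩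

lemma finrank_ker_circulantOf_transpose (hn : 0 < n) (hdvd : h ∣ X ^ n - 1) :
    Module.finrank (ZMod 2) (LinearMap.ker (circulantOf n h).transpose.mulVecLin) =
      h.natDegree := by
  rw [circulantOf_transpose, finrank_ker_submatrix, finrank_ker_circulantOf hn hdvd]

lemma classicalDistance_circulantOf_transpose :
    classicalDistance (circulantOf n h).transpose = classicalDistance (circulantOf n h) := by
  rw [circulantOf_transpose, classicalDistance_submatrix]

lemma finrank_ker_redB_transpose (h0 : h ≠ 0) (hdeg : h.natDegree ≤ n) :
    Module.finrank (ZMod 2) (LinearMap.ker (redB n h).transpose.mulVecLin) = h.natDegree := by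
  rw [redB_transpose, finrank_ker_submatrix, finrank_ker_redA h0 hdeg]

lemma finrank_ker_redA_transpose (h0 : h ≠ 0) :
    Module.finrank (ZMod 2) (LinearMap.ker (redA n h).transpose.mulVecLin) = 0 := by
  rw [ker_transpose_eq_bot_redA h0, finrank_bot]

lemma classicalDistance_redB_transpose (hn : 0 < n) (hdvd : h ∣ X ^ n - 1) :
    classicalDistance (redB n h).transpose = classicalDistance (circulantOf n h) := by
  rw [redB_transpose, classicalDistance_submatrix, classicalDistance_redA hn hdvd]

lemma card_keptCol {r : ℕ} (hr : r ≤ n) : Fintype.card (KeptCol n r) = n - r := by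
  rw [Fintype.card_congr (keptColEquivKeptRow n r), card_keptRow hr]

lemma parentCode_hasParameters {d : ℕ∞} (hℓ : 0 < ℓ) (hm : 0 < m) (hA : A ∣ X ^ ℓ - 1)
    (hB : B ∣ X ^ m - 1) (hd : distance (parentCode ℓ m A B) = d) :
    HasParameters (parentCode ℓ m A B) (2 * ℓ * m) (2 * (A.natDegree * B.natDegree)) d := by
  rw [parentCode_eq] at hd ⊢
  convert hypergraphProduct_hasParameters ?_ hd using 1
  · simp; ring
  · rw [Matrix.transpose_transpose, finrank_ker_circulantOf hℓ hA, finrank_ker_circulantOf hm hB,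
      finrank_ker_circulantOf_transpose hℓ hA, finrank_ker_circulantOf_transpose hm hB, two_mul]

lemma prunedCode_hasParameters {d : ℕ∞} (hℓ : 0 < ℓ) (hm : 0 < m) (hA : A ∣ X ^ ℓ - 1)
    (hB : B ∣ X ^ m - 1) (hd : distance (prunedCode ℓ m A B) = d) :
    HasParameters (prunedCode ℓ m A B) (ℓ * m + (ℓ - A.natDegree) * (m - B.natDegree))
      (A.natDegree * B.natDegree) d := by
  have hA0 := ne_zero_of_dvd_ne_zero (X_pow_sub_one_ne_zero hℓ) hA
  have hB0 := ne_zero_of_dvd_ne_zero (X_pow_sub_one_ne_zero hm) hB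
  have hAd := natDegree_le_of_dvd_X_pow_sub_one hℓ hA
  have hBd := natDegree_le_of_dvd_X_pow_sub_one hm hB
  rw [prunedCode] at hd ⊢
  convert hypergraphProduct_hasParameters ?_ hd using 1
  · rw [card_keptRow hAd, card_keptCol hBd, Fintype.card_fin, Fintype.card_fin]
  · rw [finrank_ker_redA hA0 hAd, finrank_ker_redB_transpose hB0 hBd,
      finrank_ker_redA_transpose hA0, zero_mul, add_zero]

lemma distance_parentCode (hℓ : 0 < ℓ) (hm : 0 < m) (hA : A ∣ X ^ ℓ - 1) (hB : B ∣ X ^ m - 1)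
    (hA0 : 0 < A.natDegree) (hB0 : 0 < B.natDegree) :
    distance (parentCode ℓ m A B) =
      min (classicalDistance (circulantOf ℓ A)) (classicalDistance (circulantOf m B)) := by
  rw [parentCode_eq]
  apply le_antisymm
  · obtain ⟨a, ha, ha0⟩ := exists_mulVec_eq_zero ((finrank_ker_circulantOf hℓ hA).symm ▸ hA0)
    obtain ⟨b, hb, hb0⟩ :=
      exists_mulVec_eq_zero ((finrank_ker_circulantOf_transpose hm hB).symm ▸ hB0)
    refine le_min (distance_hypergraphProduct_le_left hb hb0) ?_
    rw [← classicalDistance_circulantOf_transpose (n := m)]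
    exact distance_hypergraphProduct_le_right ha ha0
  · refine le_distance_hypergraphProduct (fun a b ha hb ha0 hb0 => ⟨?_, ?_⟩)
      fun a b ha hb ha0 hb0 => ⟨?_, ?_⟩
    · exact (min_le_left _ _).trans (classicalDistance_le ha ha0)
    · rw [← classicalDistance_circulantOf_transpose (n := m)]
      exact (min_le_right _ _).trans (classicalDistance_le hb hb0)
    · rw [← classicalDistance_circulantOf_transpose (n := ℓ)]
      exact (min_le_left _ _).trans (classicalDistance_le ha ha0)
    · exact (min_le_right _ _).trans (classicalDistance_le hb hb0)

lemma distance_prunedCode (hℓ : 0 < ℓ) (hm : 0 < m) (hA : A ∣ X ^ ℓ - 1) (hB : B ∣ X ^ m - 1)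
    (hA0 : 0 < A.natDegree) (hB0 : 0 < B.natDegree) :
    distance (prunedCode ℓ m A B) =
      min (classicalDistance (circulantOf ℓ A)) (classicalDistance (circulantOf m B)) := by
  have hAne := ne_zero_of_dvd_ne_zero (X_pow_sub_one_ne_zero hℓ) hA
  have hBne := ne_zero_of_dvd_ne_zero (X_pow_sub_one_ne_zero hm) hB
  rw [prunedCode, ← classicalDistance_redA hℓ hA, ← classicalDistance_redB_transpose hm hB]
  apply le_antisymm
  · obtain ⟨a, ha, ha0⟩ := exists_mulVec_eq_zero
      ((finrank_ker_redA hAne (natDegree_le_of_dvd_X_pow_sub_one hℓ hA)).symm ▸ hA0)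
    obtain ⟨b, hb, hb0⟩ := exists_mulVec_eq_zero
      ((finrank_ker_redB_transpose hBne (natDegree_le_of_dvd_X_pow_sub_one hm hB)).symm ▸ hB0)
    exact le_min (distance_hypergraphProduct_le_left hb hb0)
      (distance_hypergraphProduct_le_right ha ha0)
  · refine le_distance_hypergraphProduct (fun a b ha hb ha0 hb0 => ⟨?_, ?_⟩)
      fun a b ha _ ha0 _ => ?_
    · exact (min_le_left _ _).trans (classicalDistance_le ha ha0)
    · exact (min_le_right _ _).trans (classicalDistance_le hb hb0)
    · exact absurd (eq_zero_of_redA_transpose_mulVec_eq_zero hAne ha) ha0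

lemma distance_parentCode_eq_top (hℓ : 0 < ℓ) (hm : 0 < m) (hA : A ∣ X ^ ℓ - 1)
    (hB : B ∣ X ^ m - 1) (h0 : A.natDegree = 0 ∨ B.natDegree = 0) :
    distance (parentCode ℓ m A B) = ⊤ := by
  rw [parentCode_eq, eq_top_iff]
  refine le_distance_hypergraphProduct (fun a b ha hb ha0 hb0 => ?_) fun a b ha hb ha0 hb0 => ?_
  · rcases h0 with h0 | h0
    · exact absurd (eq_zero_of_finrank_ker_eq_zero
        ((finrank_ker_circulantOf hℓ hA).trans h0) ha) ha0
    · exact absurd (eq_zero_of_finrank_ker_eq_zero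
        ((finrank_ker_circulantOf_transpose hm hB).trans h0) hb) hb0
  · rcases h0 with h0 | h0
    · exact absurd (eq_zero_of_finrank_ker_eq_zero
        ((finrank_ker_circulantOf_transpose hℓ hA).trans h0) ha) ha0
    · exact absurd (eq_zero_of_finrank_ker_eq_zero
        ((finrank_ker_circulantOf hm hB).trans h0) hb) hb0

lemma distance_prunedCode_eq_top (hℓ : 0 < ℓ) (hm : 0 < m) (hA : A ∣ X ^ ℓ - 1)
    (hB : B ∣ X ^ m - 1) (h0 : A.natDegree = 0 ∨ B.natDegree = 0) :
    distance (prunedCode ℓ m A B) = ⊤ := by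
  have hAne := ne_zero_of_dvd_ne_zero (X_pow_sub_one_ne_zero hℓ) hA
  have hBne := ne_zero_of_dvd_ne_zero (X_pow_sub_one_ne_zero hm) hB
  rw [prunedCode, eq_top_iff]
  refine le_distance_hypergraphProduct (fun a b ha hb ha0 hb0 => ?_) fun a b ha _ ha0 _ => ?_
  · rcases h0 with h0 | h0
    · exact absurd (eq_zero_of_finrank_ker_eq_zero ((finrank_ker_redA hAne
        (natDegree_le_of_dvd_X_pow_sub_one hℓ hA)).trans h0) ha) ha0
    · exact absurd (eq_zero_of_finrank_ker_eq_zero ((finrank_ker_redB_transpose hBne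
        (natDegree_le_of_dvd_X_pow_sub_one hm hB)).trans h0) hb) hb0
  · exact absurd (eq_zero_of_redA_transpose_mulVec_eq_zero hAne ha) ha0

end Parameters

/-! ### Locality -/

section Locality

variable {ℓ m : ℕ} {A B : (ZMod 2)[X]}

lemma mem_exponents_inX {e : ℤ × ℤ} :
    e ∈ exponents (inX A) ↔ ∃ s : ℕ, A.coeff s ≠ 0 ∧ e = ((s : ℤ), 0) := by
  constructor
  · rintro ⟨μ, hμ, rfl⟩
    rw [MvPolynomial.mem_support_iff, inX, coeff_aeval_X, ne_eq, ite_eq_right_iff,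
      Classical.not_imp] at hμ
    refine ⟨μ 0, hμ.2, ?_⟩
    have : μ 1 = 0 := by rw [hμ.1]; simp
    rw [this, Nat.cast_zero]
  · rintro ⟨s, hs, rfl⟩
    refine ⟨Finsupp.single 0 s, ?_, by simp⟩
    rwa [MvPolynomial.mem_support_iff, inX, coeff_aeval_X_single]

lemma mem_exponents_inY {e : ℤ × ℤ} :
    e ∈ exponents (inY B) ↔ ∃ t : ℕ, B.coeff t ≠ 0 ∧ e = (0, (t : ℤ)) := by
  constructor
  · rintro ⟨μ, hμ, rfl⟩
    rw [MvPolynomial.mem_support_iff, inY, coeff_aeval_X, ne_eq, ite_eq_right_iff,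
      Classical.not_imp] at hμ
    refine ⟨μ 1, hμ.2, ?_⟩
    have : μ 0 = 0 := by rw [hμ.1]; simp
    rw [this, Nat.cast_zero]
  · rintro ⟨s, hs, rfl⟩
    refine ⟨Finsupp.single 1 s, ?_, by simp⟩
    rwa [MvPolynomial.mem_support_iff, inY, coeff_aeval_X_single]

lemma exponents_inX_subset_box :
    exponents (inX A) ⊆ box (max A.natDegree B.natDegree) := by
  intro e he
  obtain ⟨s, hs, rfl⟩ := mem_exponents_inX.1 he
  have := le_natDegree_of_ne_zero hs
  simp only [box, Set.mem_ofPred_eq, Nat.abs_cast, abs_zero, Nat.cast_le]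
  exact ⟨le_max_of_le_left this, Nat.cast_nonneg _⟩

lemma exponents_inY_subset_box :
    exponents (inY B) ⊆ box (max A.natDegree B.natDegree) := by
  intro e he
  obtain ⟨s, hs, rfl⟩ := mem_exponents_inY.1 he
  have := le_natDegree_of_ne_zero hs
  simp only [box, Set.mem_ofPred_eq, Nat.abs_cast, abs_zero, Nat.cast_le]
  exact ⟨Nat.cast_nonneg _, le_max_of_le_right this⟩

lemma neg_mem_box {R : ℕ} {e : ℤ × ℤ} (h : -e ∈ box R) : e ∈ box R := by
  simpa [box] using h

lemma stencil_subset_box {κ κ' Λ Λ' : Type*} (i : κ ⊕ κ') (q : Λ ⊕ Λ') :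
    stencil (inX A) (inY B) i q ⊆ box (max A.natDegree B.natDegree) := by
  rcases i with i | i <;> rcases q with q | q
  · exact exponents_inX_subset_box
  · exact exponents_inY_subset_box
  · exact fun e he => neg_mem_box (exponents_inY_subset_box he)
  · exact fun e he => neg_mem_box (exponents_inX_subset_box he)

lemma exists_sub_eq_of_circulantOf_ne_zero {n : ℕ} {h : (ZMod 2)[X]} {i j : Fin n}
    (hij : circulantOf n h i j ≠ 0) :
    ∃ s, h.coeff s ≠ 0 ∧ ∃ a : ℤ, ((i : ℕ) : ℤ) - ((j : ℕ) : ℤ) = s + a * n := by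
  obtain ⟨s, hs, h1⟩ := exists_of_circulantOf_ne_zero hij
  refine ⟨s, hs, -(((j : ℕ) + s) / n : ℕ), ?_⟩
  have := Nat.mod_add_div ((j : ℕ) + s) n
  rw [← h1] at this
  zify at this ⊢
  linear_combination this

lemma isLocalPeriodic_parentCode :
    IsLocalPeriodic ℓ m (parentCode ℓ m A B) pos pos (stencil (inX A) (inY B)) := by
  rw [parentCode_eq]
  rintro (⟨i, j⟩ | ⟨i, j⟩) (⟨i', j'⟩ | ⟨i', j'⟩) h
  · have h : circulantOf ℓ A i i' * (1 : Matrix (Fin m) (Fin m) (ZMod 2)) j j' ≠ 0 :=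
      h.resolve_right fun h => h rfl
    obtain rfl : j = j' := by
      by_contra hne
      exact h (by rw [Matrix.one_apply_ne hne, mul_zero])
    obtain ⟨s, hs, a, ha⟩ := exists_sub_eq_of_circulantOf_ne_zero (left_ne_zero_of_mul h)
    exact ⟨(s, 0), mem_exponents_inX.2 ⟨s, hs, rfl⟩, a, 0, by simp [pos, ha]⟩
  · have h : (1 : Matrix (Fin ℓ) (Fin ℓ) (ZMod 2)) i i' * circulantOf m B j j' ≠ 0 :=
      h.resolve_right fun h => h rfl
    obtain rfl : i = i' := by
      by_contra hne
      exact h (by rw [Matrix.one_apply_ne hne, zero_mul])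
    obtain ⟨s, hs, a, ha⟩ := exists_sub_eq_of_circulantOf_ne_zero (right_ne_zero_of_mul h)
    exact ⟨(0, s), mem_exponents_inY.2 ⟨s, hs, rfl⟩, 0, a, by simp [pos, ha]⟩
  · have h : (1 : Matrix (Fin ℓ) (Fin ℓ) (ZMod 2)) i i' * circulantOf m B j' j ≠ 0 :=
      h.resolve_left fun h => h rfl
    obtain rfl : i = i' := by
      by_contra hne
      exact h (by rw [Matrix.one_apply_ne hne, zero_mul])
    obtain ⟨s, hs, a, ha⟩ := exists_sub_eq_of_circulantOf_ne_zero (right_ne_zero_of_mul h)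
    refine ⟨(0, -s), mem_exponents_inY.2 ⟨s, hs, by simp⟩, 0, -a, ?_⟩
    simp only [pos, Sum.elim_inl, Sum.elim_inr, Prod.mk_sub_mk, Prod.mk_add_mk, Prod.mk.injEq]
    constructor <;> linarith
  · have h : circulantOf ℓ A i' i * (1 : Matrix (Fin m) (Fin m) (ZMod 2)) j j' ≠ 0 :=
      h.resolve_left fun h => h rfl
    obtain rfl : j = j' := by
      by_contra hne
      exact h (by rw [Matrix.one_apply_ne hne, mul_zero])
    obtain ⟨s, hs, a, ha⟩ := exists_sub_eq_of_circulantOf_ne_zero (left_ne_zero_of_mul h)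
    refine ⟨(-s, 0), mem_exponents_inX.2 ⟨s, hs, by simp⟩, -a, 0, ?_⟩
    simp only [pos, Sum.elim_inr, Prod.mk_sub_mk, Prod.mk_add_mk, Prod.mk.injEq]
    constructor <;> linarith

lemma exists_sub_eq_of_redA_ne_zero {i : KeptRow ℓ A.natDegree} {j : Fin ℓ}
    (hij : redA ℓ A i j ≠ 0) :
    ∃ s, A.coeff s ≠ 0 ∧ (((i : Fin ℓ) : ℕ) : ℤ) - ((j : ℕ) : ℤ) = s := by
  rw [redA_apply, ne_eq, ite_eq_right_iff, Classical.not_imp] at hij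
  exact ⟨_, hij.2, by have := hij.1; omega⟩

lemma exists_sub_eq_of_redB_ne_zero {i : Fin m} {j : KeptCol m B.natDegree}
    (hij : redB m B i j ≠ 0) :
    ∃ t, B.coeff t ≠ 0 ∧ ((i : ℕ) : ℤ) - (((j : Fin m) : ℕ) : ℤ) = t := by
  obtain ⟨t, ht, h1⟩ := exists_of_circulantOf_ne_zero (n := m) hij
  have h2 := le_natDegree_of_ne_zero ht
  have h3 := j.2
  -- the deleted columns are those whose entries can wrap around
  have h4 : ((j : Fin m) : ℕ) + t < m := by omega
  refine ⟨t, ht, ?_⟩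
  change (i : ℕ) = (((j : Fin m) : ℕ) + t) % m at h1
  rw [Nat.mod_eq_of_lt h4] at h1
  omega

lemma isLocalOpen_prunedCode :
    IsLocalOpen (prunedCode ℓ m A B) (fun i => pos (keepCheck i)) (fun q => pos (keepQubit q))
      (stencil (inX A) (inY B)) := by
  rintro (⟨i, j⟩ | ⟨i, j⟩) (⟨i', j'⟩ | ⟨i', j'⟩) h
  · have h : redA ℓ A i i' * (1 : Matrix (Fin m) (Fin m) (ZMod 2)) j j' ≠ 0 :=
      h.resolve_right fun h => h rfl
    obtain rfl : j = j' := by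
      by_contra hne
      exact h (by rw [Matrix.one_apply_ne hne, mul_zero])
    obtain ⟨s, hs, hd⟩ := exists_sub_eq_of_redA_ne_zero (left_ne_zero_of_mul h)
    exact mem_exponents_inX.2 ⟨s, hs, by simp [pos, keepCheck, keepQubit, hd]⟩
  · have h : (1 : Matrix (KeptRow ℓ A.natDegree) (KeptRow ℓ A.natDegree) (ZMod 2)) i i' *
        redB m B j j' ≠ 0 := h.resolve_right fun h => h rfl
    obtain rfl : i = i' := by
      by_contra hne
      exact h (by rw [Matrix.one_apply_ne hne, zero_mul])
    obtain ⟨s, hs, hd⟩ := exists_sub_eq_of_redB_ne_zero (right_ne_zero_of_mul h)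
    exact mem_exponents_inY.2 ⟨s, hs, by simp [pos, keepCheck, keepQubit, hd]⟩
  · have h : (1 : Matrix (Fin ℓ) (Fin ℓ) (ZMod 2)) i i' * redB m B j' j ≠ 0 :=
      h.resolve_left fun h => h rfl
    obtain rfl : i = i' := by
      by_contra hne
      exact h (by rw [Matrix.one_apply_ne hne, zero_mul])
    obtain ⟨s, hs, hd⟩ := exists_sub_eq_of_redB_ne_zero (right_ne_zero_of_mul h)
    exact mem_exponents_inY.2 ⟨s, hs, by simp [pos, keepCheck, keepQubit, hd]⟩
  · have h : redA ℓ A i' i * (1 : Matrix (KeptCol m B.natDegree) (KeptCol m B.natDegree)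
        (ZMod 2)) j j' ≠ 0 := h.resolve_left fun h => h rfl
    obtain rfl : j = j' := by
      by_contra hne
      exact h (by rw [Matrix.one_apply_ne hne, mul_zero])
    obtain ⟨s, hs, hd⟩ := exists_sub_eq_of_redA_ne_zero (left_ne_zero_of_mul h)
    exact mem_exponents_inX.2 ⟨s, hs, by simp [pos, keepCheck, keepQubit, hd]⟩

lemma IsLocalPeriodic.mono {Q ι : Type*} {S : ι → PauliString Q} {posC : ι → ℤ × ℤ}
    {posQ : Q → ℤ × ℤ} {D D' : ι → Q → Set (ℤ × ℤ)} (h : IsLocalPeriodic ℓ m S posC posQ D)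
    (hD : ∀ i q, D i q ⊆ D' i q) : IsLocalPeriodic ℓ m S posC posQ D' := by
  intro i q hiq
  obtain ⟨e, he, h⟩ := h i q hiq
  exact ⟨e, hD i q he, h⟩

lemma IsLocalOpen.mono {Q ι : Type*} {S : ι → PauliString Q} {posC : ι → ℤ × ℤ}
    {posQ : Q → ℤ × ℤ} {D D' : ι → Q → Set (ℤ × ℤ)} (h : IsLocalOpen S posC posQ D)
    (hD : ∀ i q, D i q ⊆ D' i q) : IsLocalOpen S posC posQ D' :=
  fun i q hiq => hD i q (h i q hiq)

end Locality

end PrunedBB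

theorem mainTheorem1 (ℓ m : ℕ) (hℓ : 0 < ℓ) (hm : 0 < m) (A B : Polynomial (ZMod 2))
    (hA : A ∣ Polynomial.X ^ ℓ - 1) (hB : B ∣ Polynomial.X ^ m - 1) :
    -- the hypergraph product is a pruned version of the bicycle code
    PrunedBB.IsPrunedVersion (PrunedBB.prunedCode ℓ m A B) (PrunedBB.parentCode ℓ m A B)
      PrunedBB.keepQubit PrunedBB.keepCheck ∧
    -- parameters of the two codes, nonconstant polynomials
    (0 < A.natDegree → 0 < B.natDegree →
      PrunedBB.HasParameters (PrunedBB.parentCode ℓ m A B)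
        (2 * ℓ * m) (2 * (A.natDegree * B.natDegree))
        (min (PrunedBB.classicalDistance (PrunedBB.circulantOf ℓ A))
          (PrunedBB.classicalDistance (PrunedBB.circulantOf m B))) ∧
      PrunedBB.HasParameters (PrunedBB.prunedCode ℓ m A B)
        (ℓ * m + (ℓ - A.natDegree) * (m - B.natDegree)) (A.natDegree * B.natDegree)
        (min (PrunedBB.classicalDistance (PrunedBB.circulantOf ℓ A))
          (PrunedBB.classicalDistance (PrunedBB.circulantOf m B)))) ∧
    -- degenerate case: no logical qubits, hence no nontrivial logical operators, in both codes
    (A.natDegree = 0 ∨ B.natDegree = 0 →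
      PrunedBB.HasParameters (PrunedBB.parentCode ℓ m A B) (2 * ℓ * m) 0 ⊤ ∧
      PrunedBB.HasParameters (PrunedBB.prunedCode ℓ m A B)
        (ℓ * m + (ℓ - A.natDegree) * (m - B.natDegree)) 0 ⊤) ∧
    -- the parent code is local on the periodic lattice, the pruned code is equally local on the
    -- open lattice: first with the same displacements, then with the same interaction range
    PrunedBB.IsLocalPeriodic ℓ m (PrunedBB.parentCode ℓ m A B) PrunedBB.pos PrunedBB.pos
      (PrunedBB.stencil (PrunedBB.inX A) (PrunedBB.inY B)) ∧
    PrunedBB.IsLocalOpen (PrunedBB.prunedCode ℓ m A B)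
      (fun i => PrunedBB.pos (PrunedBB.keepCheck i)) (fun q => PrunedBB.pos (PrunedBB.keepQubit q))
      (PrunedBB.stencil (PrunedBB.inX A) (PrunedBB.inY B)) ∧
    PrunedBB.IsLocalPeriodic ℓ m (PrunedBB.parentCode ℓ m A B) PrunedBB.pos PrunedBB.pos
      (fun _ _ => PrunedBB.box (max A.natDegree B.natDegree)) ∧
    PrunedBB.IsLocalOpen (PrunedBB.prunedCode ℓ m A B)
      (fun i => PrunedBB.pos (PrunedBB.keepCheck i)) (fun q => PrunedBB.pos (PrunedBB.keepQubit q))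
      (fun _ _ => PrunedBB.box (max A.natDegree B.natDegree)) := by
  refine ⟨PrunedBB.isPrunedVersion_prunedCode ℓ m A B, fun hA0 hB0 => ⟨?_, ?_⟩,
    fun h0 => ⟨?_, ?_⟩, PrunedBB.isLocalPeriodic_parentCode, PrunedBB.isLocalOpen_prunedCode,
    PrunedBB.isLocalPeriodic_parentCode.mono fun _ _ => PrunedBB.stencil_subset_box _ _,
    PrunedBB.isLocalOpen_prunedCode.mono fun _ _ => PrunedBB.stencil_subset_box _ _⟩
  · exact PrunedBB.parentCode_hasParameters hℓ hm hA hB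
      (PrunedBB.distance_parentCode hℓ hm hA hB hA0 hB0)
  · exact PrunedBB.prunedCode_hasParameters hℓ hm hA hB
      (PrunedBB.distance_prunedCode hℓ hm hA hB hA0 hB0)
  · have hk : 2 * (A.natDegree * B.natDegree) = 0 := by
      rw [mul_eq_zero.2 h0, mul_zero]
    exact hk ▸ PrunedBB.parentCode_hasParameters hℓ hm hA hB
      (PrunedBB.distance_parentCode_eq_top hℓ hm hA hB h0)
  · have hk : A.natDegree * B.natDegree = 0 := mul_eq_zero.2 h0
    exact hk ▸ PrunedBB.prunedCode_hasParameters hℓ hm hA hB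
      (PrunedBB.distance_prunedCode_eq_top hℓ hm hA hB h0)
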